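/- Theorem 6 (minimum number of decoding attempts for mBM-1). Logarithms are to base 2, $H(u)=-u\log u-(1-u)\log(1-u)$, $D_{\mathrm{KL}}(u\|p)=u\log\frac{u}{p}+(1-u)\log\frac{1-u}{1-p}$, $[x]^+=\max\{x,0\}$. Setting. Words over a finite alphabet of $m\ge 2$ symbols are sent over the memoryless $m$-ary symmetric channel, $\Pr(r|c)=p$ if $r=c$ and $\Pr(r|c)=(1-p)/(m-1)$ if $r\ne c$, with $(1-p)/(m-1)<p<1$. In mBM-1 decoding of a code of length $n$ and dimension $K$, a set $\mathcal B$ of erasure patterns is used, one errors-and-erasures decoding attempt for each pattern. An attempt succeeds if and only if $2\nu+e<n-K+1$, where $e$ is the number of erased positions and $\nu$ is the number of unerased positions at which the received symbol differs from the transmitted one. Let $p_e$ be the probability that no attempt succeeds. Fix an integer $N\ge 1$, a real $D$ with $1-p<D/N\le 1$, and a real $F\in[0,\,N D_{\mathrm{KL}}(1-\frac DN\|p)]$. Consider block lengths $n\to\infty$ and dimensions $K_n$ with $(n-K_n+1)/n\to D/N$. Sets $\mathcal B_n$ of erasure patterns of length $n$ achieve the rate-distortion exponent $F$ (i.e. $F/N$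 per symbol) if $p_e\to0$ and, for every $\epsilon>0$, $p_e\le 2^{-n(F/N-\epsilon)}$ for all large $n$, whatever words are transmitted; they consist of $2^R$ attempts (i.e. rate at most $R/N$ per symbol) if, for every $\epsilon>0$, $|\mathcal B_n|\le 2^{n(R/N+\epsilon)}$ for all large $n$. Claim. The map $g(u)=D_{\mathrm{KL}}(u\|p)$ is a bijection from $[1-\frac DN,\,p]$ onto $[0,\,D_{\mathrm{KL}}(1-\frac DN\|p)]$; let $g^{-1}$ be its inverse. The least $R\in\mathbb R$ for which some sets $\mathcal B_n$ consisting of $2^R$ attempts achieve the exponent $F$ exists and is $$R=N\left[H\!\left(g^{-1}\!\left(\tfrac FN\right)\right)-H\!\left(g^{-1}\!\left(\tfrac FN\right)+\tfrac DN-1\right)\right]^+ .$$ Moreover, for this $R$, if $F>0$ and $D<N$, then the exponent $F$ is achieved by sets with $|\mathcal B_n|\le 2^{nR/N}$ for every $n$. -/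

import Mathlib

open Set Filter Topology

/-- Binary entropy in bits, `H(u) = -u log₂ u - (1-u) log₂ (1-u)`. -/
noncomputable def entropyBits (u : ℝ) : ℝ := Real.binEntropy u / Real.log 2

/-- Binary Kullback-Leibler divergence in bits,
`D_KL(u‖p) = u log₂ (u/p) + (1-u) log₂ ((1-u)/(1-p))`. -/
noncomputable def klBits (u p : ℝ) : ℝ :=
  u * Real.logb 2 (u / p) + (1 - u) * Real.logb 2 ((1 - u) / (1 - p))

/-- The inverse of `g(u) = D_KL(u‖p)` on `[1 - δ, p]`. -/
noncomputable def klBitsInv (p δ : ℝ) : ℝ → ℝ :=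
  Function.invFunOn (fun u => klBits u p) (Icc (1 - δ) p)

open Classical in
/-- Transition probability `Pr(r | c)` of the `m`-ary symmetric channel on the alphabet `A`,
`m = |A|`. -/
noncomputable def mSC {A : Type*} [Fintype A] (p : ℝ) (c r : A) : ℝ :=
  if r = c then p else (1 - p) / ((Fintype.card A : ℝ) - 1)

/-- An erasure pattern of length `n`: position `i` is erased iff the value at `i` is `false`. -/
abbrev ErasurePattern (n : ℕ) : Type := Fin n → Bool

/-- Number `e` of erased positions. -/
def numErasures {n : ℕ} (x : ErasurePattern n) : ℕ :=
  (Finset.univ.filter fun i => x i = false).card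

open Classical in
/-- Number `ν` of hard-decision errors in the unerased positions. For the `m`-ary symmetric
channel with `p > (1-p)/(m-1)` the hard decision is the received symbol. -/
noncomputable def numErrors {A : Type*} {n : ℕ} (c r : Fin n → A) (x : ErasurePattern n) : ℕ :=
  (Finset.univ.filter fun i => x i = true ∧ r i ≠ c i).card

/-- Success of one errors-and-erasures decoding attempt for a code of length `n` and
dimension `K`: `2ν + e < n - K + 1`. -/
def AttemptSucceeds {A : Type*} {n : ℕ} (K : ℕ) (c r : Fin n → A) (x : ErasurePattern n) : Prop :=
  2 * (numErrors c r x : ℤ) + (numErasures x : ℤ) < (n : ℤ) - (K : ℤ) + 1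

open Classical in
/-- Probability, over the memoryless `m`-ary symmetric channel with transmitted word `c`, that
no attempt with an erasure pattern in `B` succeeds. -/
noncomputable def failureProb {A : Type*} [Fintype A] {n : ℕ} (p : ℝ) (K : ℕ)
    (B : Finset (ErasurePattern n)) (c : Fin n → A) : ℝ :=
  ∑ r : Fin n → A,
    if ∃ x ∈ B, AttemptSucceeds K c r x then 0 else ∏ i, mSC p (c i) (r i)

/-- The number of decoding attempts is at most `2 ^ (n (ρ + o(1)))`. -/
def HasRateAtMost (B : ∀ n, Finset (ErasurePattern n)) (ρ : ℝ) : Prop :=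
  ∀ ε : ℝ, 0 < ε → ∀ᶠ n : ℕ in atTop, ((B n).card : ℝ) ≤ (2 : ℝ) ^ ((n : ℝ) * (ρ + ε))

/-- The sets `B n` of erasure patterns achieve the (normalized) exponent `φ`, whatever words are
transmitted: the failure probability tends to zero and is at most `2 ^ (-n (φ - o(1)))`.
The first requirement follows from the second when `φ > 0`. -/
def AchievesExponent (A : Type*) [Fintype A] (p : ℝ) (K : ℕ → ℕ)
    (B : ∀ n, Finset (ErasurePattern n)) (φ : ℝ) : Prop :=
  ∀ c : ∀ n : ℕ, Fin n → A,
    Tendsto (fun n => failureProb p (K n) (B n) (c n)) atTop (𝓝 0) ∧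
    ∀ ε : ℝ, 0 < ε → ∀ᶠ n : ℕ in atTop,
      failureProb p (K n) (B n) (c n) ≤ (2 : ℝ) ^ (-((n : ℝ) * (φ - ε)))

/-- `N [H(g⁻¹(F/N)) - H(g⁻¹(F/N) + D/N - 1)]⁺`, the base-two logarithm of the number of
attempts. -/
noncomputable def attemptRate (p : ℝ) (N : ℕ) (D F : ℝ) : ℝ :=
  (N : ℝ) * max 0 (entropyBits (klBitsInv p (D / N) (F / N)) -
    entropyBits (klBitsInv p (D / N) (F / N) + D / N - 1))

/-! Only the set `W` of erroneous positions matters: it has probability `(1-p)^|W| p^(n-|W|)`,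
whatever the alphabet and the transmitted word. With `E` the erased set and `t = n - K`, success
means `2|W \ E| + |E| ≤ t`, and the left side equals `|W| + |W ∆ E|`. So decoding all errors of
weight `k` amounts to covering a layer of the Hamming cube by balls of radius `t - k`. With `k ≈ τn`
and `t ≈ δn`, this is rate-distortion for a Bernoulli(`τ`) source at distortion `δ - τ`, with rate
`[h(τ) - h(δ-τ)]⁺`.

Achievability: greedy covering attains this rate (`exists_coversLayer_asymptotic`). Since `2|W \ E|
+ |E|` is monotone in `W`, covering one layer handles all lighter errors too, so failure requires
more than `k` errors. The Chernoff bound gives this event the exponent `D_KL(1-τ‖p)`, which fixes `τ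
= 1 - g⁻¹(F/N)`; when `F = 0` the Chebyshev bound still gives failure probability tending to zero.

Converse: an exponent exceeding that of an error rate `σ < τ` forces half of the layer at `σ` to be
covered (`exists_half_covered`). Counting ball volumes then forces the rate to be at least `h(σ) -
h(δ-σ)` (`entropy_sub_le_of_half_covered`), and `σ → τ`. When `F = 0`, a typical layer near `1 - p`
replaces `σ`.

No slack in the cardinality: for `δ < 1` the rate `h(σ) - h(δ-σ)` is strictly increasing in `σ`, so
layers below `τ` leave exponential room for the polynomial factors. -/

/-! ### Exponential growth of factorials and binomial coefficients. -/

theorem log_factorial_lower (m : ℕ) :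
    (m : ℝ) * Real.log m - m ≤ Real.log (m.factorial : ℝ) := by
  rcases Nat.eq_zero_or_pos m with rfl | hm
  · simp
  · have h := Stirling.le_log_factorial_stirling hm.ne'
    have h1 : 0 ≤ Real.log m := Real.log_natCast_nonneg m
    have h2 : 0 ≤ Real.log (2 * Real.pi) :=
      Real.log_nonneg (by nlinarith [Real.pi_gt_three])
    linarith

/-- Elementary Stirling bound; the error `log m + 1` is crude but vanishes after division by `n`.
The induction reduces to `(m+1)(log(m+1) - log m) ≥ 1`. -/
theorem log_factorial_upper (m : ℕ) :
    Real.log (m.factorial : ℝ) ≤ (m : ℝ) * Real.log m - m + (Real.log m + 1) := by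
  induction m with
  | zero => simp
  | succ m ih =>
    rcases Nat.eq_zero_or_pos m with rfl | hm
    · simp
    · have hm' : (0 : ℝ) < m := by exact_mod_cast hm
      have h1 : Real.log ((m + 1).factorial : ℝ) = Real.log (m + 1) + Real.log (m.factorial : ℝ) := by
        rw [Nat.factorial_succ]
        push_cast
        exact Real.log_mul (by positivity) (by exact_mod_cast m.factorial_ne_zero)
      have h2 : 1 - ((m : ℝ) + 1) / m ≤ 0 := by
        rw [sub_nonpos, one_le_div hm']; linarith
      have h3 : 1 ≤ ((m : ℝ) + 1) * (Real.log (m + 1) - Real.log m) := by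
        have := Real.one_sub_inv_le_log_of_pos (show (0 : ℝ) < (m + 1) / m by positivity)
        rw [Real.log_div (by positivity) (by positivity)] at this
        calc (1 : ℝ) = (m + 1) * (1 - ((m + 1 : ℝ) / m)⁻¹) := by field_simp; ring
          _ ≤ _ := by gcongr
      rw [h1]
      push_cast
      nlinarith

theorem tendsto_log_natCast_add_one_div :
    Tendsto (fun n : ℕ => (Real.log n + 1) / (n : ℝ)) atTop (𝓝 0) := by
  have h1 : Tendsto (fun n : ℕ => Real.log n / (n : ℝ)) atTop (𝓝 0) := by
    have := (Real.isLittleO_log_id_atTop.tendsto_div_nhds_zero).comp tendsto_natCast_atTop_atTop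
    simpa [Function.comp_def] using this
  have h2 := h1.add (tendsto_one_div_atTop_nhds_zero_nat (𝕜 := ℝ))
  simpa [add_div] using h2

/-- First-order asymptotics of `log m!` along `m / n → x`. -/
theorem tendsto_log_factorial {m : ℕ → ℕ} {x : ℝ}
    (hm : Tendsto (fun n => (m n : ℝ) / n) atTop (𝓝 x)) (hle : ∀ᶠ n in atTop, m n ≤ n) :
    Tendsto (fun n : ℕ => Real.log ((m n).factorial : ℝ) / n - (m n : ℝ) / n * Real.log n)
      atTop (𝓝 (-Real.negMulLog x - x)) := by
  have hmain : Tendsto (fun n : ℕ => -Real.negMulLog ((m n : ℝ) / n) - (m n : ℝ) / n)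
      atTop (𝓝 (-Real.negMulLog x - x)) :=
    ((Real.continuous_negMulLog.tendsto x).comp hm).neg.sub hm
  have key : ∀ᶠ n : ℕ in atTop,
      -Real.negMulLog ((m n : ℝ) / n) - (m n : ℝ) / n =
        ((m n : ℝ) * Real.log (m n) - m n) / n - (m n : ℝ) / n * Real.log n := by
    filter_upwards [eventually_gt_atTop 0] with n hn
    have hn' : (0 : ℝ) < n := by exact_mod_cast hn
    rcases Nat.eq_zero_or_pos (m n) with h | h
    · simp [h]
    · have hm' : (0 : ℝ) < m n := by exact_mod_cast h
      rw [Real.negMulLog, Real.log_div hm'.ne' hn'.ne']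
      field_simp
      ring
  refine tendsto_of_tendsto_of_tendsto_of_le_of_le' hmain
    (by simpa using hmain.add tendsto_log_natCast_add_one_div) ?_ ?_
  · filter_upwards [key] with n h
    rw [h]
    gcongr
    exact log_factorial_lower _
  · filter_upwards [key, hle, eventually_gt_atTop 0] with n h hn h0
    rw [h]
    have h1 : Real.log (m n) ≤ Real.log n := by
      rcases Nat.eq_zero_or_pos (m n) with h | h
      · simp [h, Real.log_natCast_nonneg]
      · exact Real.log_le_log (by exact_mod_cast h) (by exact_mod_cast hn)
    have h2 : Real.log ((m n).factorial : ℝ) / n ≤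
        ((m n : ℝ) * Real.log (m n) - m n) / n + (Real.log n + 1) / n := by
      rw [← add_div]
      gcongr
      linarith [log_factorial_upper (m n)]
    linarith

theorem log_choose {j b : ℕ} (h : b ≤ j) : Real.log (j.choose b : ℝ) =
    Real.log (j.factorial : ℝ) - Real.log (b.factorial : ℝ) - Real.log ((j - b).factorial : ℝ) := by
  rw [Nat.cast_choose ℝ h, Real.log_div (by exact_mod_cast j.factorial_ne_zero)
    (by exact_mod_cast mul_ne_zero b.factorial_ne_zero (j-b).factorial_ne_zero),
    Real.log_mul (by exact_mod_cast b.factorial_ne_zero) (by exact_mod_cast (j-b).factorial_ne_zero)]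
  ring

/-- Exponential growth rate of binomial coefficients. -/
theorem tendsto_log_choose {j b : ℕ → ℕ} {x y : ℝ}
    (hj : Tendsto (fun n => (j n : ℝ) / n) atTop (𝓝 x))
    (hb : Tendsto (fun n => (b n : ℝ) / n) atTop (𝓝 y))
    (hbj : ∀ᶠ n in atTop, b n ≤ j n) (hjn : ∀ᶠ n in atTop, j n ≤ n) :
    Tendsto (fun n : ℕ => Real.log ((j n).choose (b n) : ℝ) / n) atTop
      (𝓝 (Real.negMulLog y + Real.negMulLog (x - y) - Real.negMulLog x)) := by
  have hd : Tendsto (fun n => ((j n - b n : ℕ) : ℝ) / n) atTop (𝓝 (x - y)) := by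
    refine (hj.sub hb).congr' ?_
    filter_upwards [hbj] with n h
    rw [Nat.cast_sub h, sub_div]
  have h1 := tendsto_log_factorial hj hjn
  have h2 := tendsto_log_factorial hb (by filter_upwards [hbj, hjn] with n h h'; omega)
  have h3 := tendsto_log_factorial hd (by filter_upwards [hbj, hjn] with n h h'; omega)
  have h4 := (h1.sub h2).sub h3
  have e : -Real.negMulLog x - x - (-Real.negMulLog y - y) -
      (-Real.negMulLog (x - y) - (x - y)) =
      Real.negMulLog y + Real.negMulLog (x - y) - Real.negMulLog x := by ring
  rw [e] at h4
  refine h4.congr' ?_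
  filter_upwards [hbj] with n h
  rw [log_choose h, Nat.cast_sub h]
  ring

theorem tendsto_log_choose_self {b : ℕ → ℕ} {y : ℝ}
    (hb : Tendsto (fun n => (b n : ℝ) / n) atTop (𝓝 y)) (hbn : ∀ᶠ n in atTop, b n ≤ n) :
    Tendsto (fun n : ℕ => Real.log (n.choose (b n) : ℝ) / n) atTop (𝓝 (Real.binEntropy y)) := by
  have h1 : Tendsto (fun n : ℕ => (n : ℝ) / n) atTop (𝓝 1) := by
    refine tendsto_const_nhds.congr' ?_
    filter_upwards [eventually_gt_atTop 0] with n hn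
    field_simp
  have := tendsto_log_choose (j := fun n => n) h1 hb hbn (by simp)
  simpa [Real.binEntropy_eq_negMulLog_add_negMulLog_one_sub] using this

/-! ### Greedy covering. -/

/-- Greedy covering: if each point of `X` is related to at least `d` points of `Y`, then `s` points
of `Y` can be chosen so that at most a fraction `(1 - d / |Y|) ^ s` of `X` is left uncovered. -/
theorem exists_greedy_cover {α β : Type*} [DecidableEq β] (X : Finset α)
    (Y : Finset β) (R : α → β → Prop) [∀ x y, Decidable (R x y)] (d : ℕ)
    (hd : ∀ x ∈ X, d ≤ (Y.filter fun y => R x y).card) (s : ℕ) :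
    ∃ B : Finset β, B.card ≤ s ∧
      (X.filter fun x => ¬ ∃ y ∈ B, R x y).card * Y.card ^ s ≤ X.card * (Y.card - d) ^ s := by
  induction s with
  | zero => exact ⟨∅, by simp, by simp⟩
  | succ s ih =>
    obtain ⟨B, hB, hU⟩ := ih
    set U := X.filter fun x => ¬ ∃ y ∈ B, R x y with hUdef
    rcases Y.eq_empty_or_nonempty with rfl | hY
    · exact ⟨B, by omega, by simp⟩
    -- Double counting: on average over `Y`, a point covers at least the fraction `d / |Y|` of the
    -- uncovered set `U`, so some `y` does.
    have hsum : ∑ _y ∈ Y, d * U.card ≤ ∑ y ∈ Y, (U.filter fun x => R x y).card * Y.card := by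
      have h1 : ∑ x ∈ U, (Y.filter fun y => R x y).card =
          ∑ y ∈ Y, (U.filter fun x => R x y).card :=
        Finset.sum_card_bipartiteAbove_eq_sum_card_bipartiteBelow R
      have h2 : ∑ _x ∈ U, d ≤ ∑ x ∈ U, (Y.filter fun y => R x y).card :=
        Finset.sum_le_sum fun x hx => hd x (Finset.mem_filter.1 hx).1
      rw [Finset.sum_const, smul_eq_mul, mul_comm, h1] at h2
      rw [Finset.sum_const, smul_eq_mul, mul_comm Y.card, ← Finset.sum_mul]
      gcongr
    obtain ⟨y, -, hy⟩ := Finset.exists_le_of_sum_le hY hsum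
    refine ⟨insert y B, (Finset.card_insert_le _ _).trans (by omega), ?_⟩
    have hU' : (X.filter fun x => ¬ ∃ z ∈ insert y B, R x z) = U.filter fun x => ¬ R x y := by
      ext x
      simp only [hUdef, Finset.mem_filter, Finset.mem_insert, exists_eq_or_imp, not_or]
      tauto
    have hsplit : (U.filter fun x => R x y).card + (U.filter fun x => ¬ R x y).card = U.card :=
      Finset.card_filter_add_card_filter_not _
    rw [hU']
    have hstep : (U.filter fun x => ¬ R x y).card * Y.card ≤ U.card * (Y.card - d) := by
      rw [Nat.mul_sub]
      apply Nat.le_sub_of_add_le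
      nlinarith
    calc (U.filter fun x => ¬ R x y).card * Y.card ^ (s + 1)
        = ((U.filter fun x => ¬ R x y).card * Y.card) * Y.card ^ s := by ring
      _ ≤ (U.card * (Y.card - d)) * Y.card ^ s := by gcongr
      _ = (U.card * Y.card ^ s) * (Y.card - d) := by ring
      _ ≤ (X.card * (Y.card - d) ^ s) * (Y.card - d) := by gcongr
      _ = _ := by ring

/-- After `s > n|Y|/d` greedy choices, fewer than `2^n exp(-s d/|Y|) < 1` points remain uncovered,
hence none. -/
theorem exists_cover_of_card_le {α β : Type*} [DecidableEq β] (X : Finset α)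
    (Y : Finset β) (R : α → β → Prop) [∀ x y, Decidable (R x y)] (d n : ℕ) (hd0 : 0 < d)
    (hd : ∀ x ∈ X, d ≤ (Y.filter fun y => R x y).card) (hX : X.card ≤ 2 ^ n) :
    ∃ B : Finset β, (B.card : ℝ) ≤ (n + 2) * (Y.card / d) ∧ ∀ x ∈ X, ∃ y ∈ B, R x y := by
  rcases X.eq_empty_or_nonempty with rfl | ⟨x₀, hx₀⟩
  · exact ⟨∅, by simp; positivity, by simp⟩
  have hdY : d ≤ Y.card := (hd x₀ hx₀).trans (Finset.card_filter_le _ _)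
  have hd0' : (0 : ℝ) < d := by exact_mod_cast hd0
  have hdY' : (d : ℝ) ≤ Y.card := by exact_mod_cast hdY
  have hY0 : (0 : ℝ) < Y.card := hd0'.trans_le hdY'
  have hone : (1 : ℝ) ≤ Y.card / d := by rwa [one_le_div hd0']
  -- The `+ 1` makes `n < s d/|Y|` strict; it and the rounding are paid for by `n + 2`, since `|Y|/d
  -- ≥ 1`.
  set s := ⌈(n : ℝ) * (Y.card / d)⌉₊ + 1 with hs
  obtain ⟨B, hB, hU⟩ := exists_greedy_cover X Y R d hd s
  have hceil := Nat.ceil_lt_add_one (show 0 ≤ (n : ℝ) * (Y.card / d) by positivity)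
  have hle := Nat.le_ceil ((n : ℝ) * (Y.card / d))
  refine ⟨B, ?_, ?_⟩
  · have h1 : (B.card : ℝ) ≤ s := by exact_mod_cast hB
    have h2 : (s : ℝ) = ⌈(n : ℝ) * (Y.card / d)⌉₊ + 1 := by rw [hs]; push_cast; ring
    linarith
  · by_contra hcon
    push Not at hcon
    obtain ⟨x, hx, hxB⟩ := hcon
    have hpos : 1 ≤ (X.filter fun x => ¬ ∃ y ∈ B, R x y).card := by
      apply Finset.card_pos.2
      exact ⟨x, Finset.mem_filter.2 ⟨hx, fun ⟨y, hy, hr⟩ => hxB y hy hr⟩⟩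
    have h1 : Y.card ^ s ≤ 2 ^ n * (Y.card - d) ^ s := by
      calc Y.card ^ s ≤ (X.filter fun x => ¬ ∃ y ∈ B, R x y).card * Y.card ^ s :=
            Nat.le_mul_of_pos_left _ hpos
        _ ≤ _ := hU.trans (by gcongr)
    have h2 : (Y.card : ℝ) ^ s ≤ 2 ^ n * ((Y.card : ℝ) - d) ^ s := by
      have : ((Y.card ^ s : ℕ) : ℝ) ≤ ((2 ^ n * (Y.card - d) ^ s : ℕ) : ℝ) := by exact_mod_cast h1
      push_cast [Nat.cast_sub hdY] at this
      exact this
    have h3 : (Y.card : ℝ) - d ≤ Y.card * Real.exp (-(d / Y.card)) := by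
      have := Real.add_one_le_exp (-((d : ℝ) / Y.card))
      calc (Y.card : ℝ) - d = Y.card * (-((d : ℝ) / Y.card) + 1) := by field_simp; ring
        _ ≤ _ := by gcongr
    have h4 : ((Y.card : ℝ) - d) ^ s ≤ Y.card ^ s * Real.exp (-(s * (d / Y.card))) := by
      calc ((Y.card : ℝ) - d) ^ s ≤ (Y.card * Real.exp (-(d / Y.card))) ^ s := by
            gcongr
        _ = _ := by rw [mul_pow, ← Real.exp_nat_mul, mul_neg]
    have h5 : (n : ℝ) < s * (d / Y.card) := by
      have h2 : (s : ℝ) = ⌈(n : ℝ) * (Y.card / d)⌉₊ + 1 := by rw [hs]; push_cast; ring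
      have h3 : (n : ℝ) * (Y.card / d) < s := by linarith
      calc (n : ℝ) = n * (Y.card / d) * (d / Y.card) := by field_simp
        _ < _ := by gcongr
    have h6 : (2 : ℝ) ^ n * Real.exp (-(s * (d / Y.card))) < 1 := by
      have h2e : (2 : ℝ) ≤ Real.exp 1 := by linarith [Real.add_one_le_exp (1 : ℝ)]
      calc (2 : ℝ) ^ n * Real.exp (-(s * (d / Y.card)))
          ≤ Real.exp 1 ^ n * Real.exp (-(s * (d / Y.card))) := by gcongr
        _ = Real.exp (n - s * (d / Y.card)) := by
            rw [← Real.exp_nat_mul, ← Real.exp_add]; ring_nf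
        _ < 1 := by rw [Real.exp_lt_one_iff]; linarith
    have h7 : (Y.card : ℝ) ^ s ≤ Y.card ^ s * (2 ^ n * Real.exp (-(s * (d / Y.card)))) := by
      calc _ ≤ _ := h2
        _ ≤ 2 ^ n * (Y.card ^ s * Real.exp (-(s * (d / Y.card)))) := by gcongr
        _ = _ := by ring
    have h8 : (0 : ℝ) < Y.card ^ s := by positivity
    nlinarith

/-! ### Covering a layer of error sets. -/

/-- Every error set with `k` elements is decoded with some erased set in `𝓔`, where `2ν + e ≤ t`
is the condition for success. -/
def CoversLayer {n : ℕ} (t k : ℕ) (𝓔 : Finset (Finset (Fin n))) : Prop :=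
  ∀ W : Finset (Fin n), W.card = k → ∃ E ∈ 𝓔, 2 * (W \ E).card + E.card ≤ t

/-- Delete `a` elements of `W` and add `b` from outside: the result `E` determines both choices, as
`W \ E` and `E \ W`. -/
theorem card_sdiff_powersetCard_le {n : ℕ} (W : Finset (Fin n)) (a b : ℕ) :
    W.card.choose a * (n - W.card).choose b ≤
      ((Finset.powersetCard (W.card - a + b) (Finset.univ : Finset (Fin n))).filter fun E =>
        (W \ E).card ≤ a ∧ (E \ W).card ≤ b).card := by
  have hc : (W.powersetCard a ×ˢ Wᶜ.powersetCard b).card =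
      W.card.choose a * (n - W.card).choose b := by
    rw [Finset.card_product, Finset.card_powersetCard, Finset.card_powersetCard,
      Finset.card_compl, Fintype.card_fin]
  rw [← hc]
  have key : ∀ P Q : Finset (Fin n), P ⊆ W → Q ⊆ Wᶜ →
      W \ (W \ P ∪ Q) = P ∧ (W \ P ∪ Q) \ W = Q := by
    intro P Q hP hQ
    constructor
    · ext i
      have h1 := @hP i
      have h2 := @hQ i
      simp only [Finset.mem_sdiff, Finset.mem_union, Finset.mem_compl] at *
      tauto
    · ext i
      have h1 := @hP i
      have h2 := @hQ i
      simp only [Finset.mem_sdiff, Finset.mem_union, Finset.mem_compl] at *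
      tauto
  refine Finset.card_le_card_of_injOn (fun PQ => W \ PQ.1 ∪ PQ.2) ?_ ?_
  · rintro ⟨P, Q⟩ h
    simp only [Finset.coe_product, Set.mem_prod, Finset.mem_coe, Finset.mem_powersetCard] at h
    obtain ⟨⟨hP, hPc⟩, hQ, hQc⟩ := h
    obtain ⟨h1, h2⟩ := key P Q hP hQ
    simp only [Finset.coe_filter, Finset.mem_powersetCard, Finset.subset_univ, true_and,
      Set.mem_ofPred_eq]
    refine ⟨?_, by rw [h1, hPc], by rw [h2, hQc]⟩
    rw [Finset.card_union_of_disjoint, Finset.card_sdiff_of_subset hP, hPc, hQc]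
    rw [Finset.disjoint_left]
    intro i hi hi'
    exact (Finset.mem_compl.1 (hQ hi')) (Finset.mem_sdiff.1 hi).1
  · rintro ⟨P, Q⟩ h ⟨P', Q'⟩ h' heq
    simp only [Finset.coe_product, Set.mem_prod, Finset.mem_coe, Finset.mem_powersetCard] at h h'
    obtain ⟨h1, h2⟩ := key P Q h.1.1 h.2.1
    obtain ⟨h3, h4⟩ := key P' Q' h'.1.1 h'.2.1
    simp only at heq
    rw [heq] at h1 h2
    rw [Prod.mk.injEq]
    exact ⟨h1.symm.trans h3, h2.symm.trans h4⟩

/-- On a layer `|W| = k` this turns the success condition into the Hamming ball `|W ∆ E| ≤ t - k`.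
-/
theorem two_mul_card_sdiff_add_card {α : Type*} [DecidableEq α] (W E : Finset α) :
    2 * (W \ E).card + E.card = W.card + (W \ E).card + (E \ W).card := by
  have h1 := Finset.card_sdiff_add_card_inter W E
  have h2 := Finset.card_sdiff_add_card_inter E W
  rw [Finset.inter_comm] at h2
  omega

theorem exists_coversLayer {n k a b t : ℕ} (ha : a ≤ k) (hb : b ≤ n - k) (ht : k + a + b ≤ t) :
    ∃ 𝓔 : Finset (Finset (Fin n)),
      (𝓔.card : ℝ) ≤ (n + 2) * (n.choose (k - a + b) / (k.choose a * (n - k).choose b)) ∧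
        CoversLayer t k 𝓔 := by
  obtain ⟨𝓔, h1, h2⟩ := exists_cover_of_card_le
    (Finset.powersetCard k (Finset.univ : Finset (Fin n)))
    (Finset.powersetCard (k - a + b) (Finset.univ : Finset (Fin n)))
    (fun W E => (W \ E).card ≤ a ∧ (E \ W).card ≤ b) (k.choose a * (n - k).choose b) n
    (Nat.mul_pos (Nat.choose_pos ha) (Nat.choose_pos hb)) (fun W hW => by
      have hW := (Finset.mem_powersetCard.1 hW).2
      subst hW
      exact card_sdiff_powersetCard_le W a b) (by
      rw [Finset.card_powersetCard, Finset.card_univ, Fintype.card_fin]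
      exact Nat.choose_le_two_pow n k)
  refine ⟨𝓔, ?_, fun W hW => ?_⟩
  · simpa using h1
  · obtain ⟨E, hE, h⟩ := h2 W (by simp [hW])
    refine ⟨E, hE, ?_⟩
    rw [two_mul_card_sdiff_add_card]
    omega

/-- Enlarge `W` to weight `k`: an erased set that serves the larger error set serves the smaller
one. -/
theorem CoversLayer.exists_of_card_le {n t k : ℕ} {𝓔 : Finset (Finset (Fin n))}
    (h : CoversLayer t k 𝓔) (hk : k ≤ n) (W : Finset (Fin n)) (hW : W.card ≤ k) :
    ∃ E ∈ 𝓔, 2 * (W \ E).card + E.card ≤ t := by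
  obtain ⟨W', hWW', hc⟩ := Finset.exists_superset_card_eq hW (by simpa using hk)
  obtain ⟨E, hE, hle⟩ := h W' hc
  refine ⟨E, hE, le_trans ?_ hle⟩
  gcongr

/-! ### The rate of a layer covering. -/

/-- Backward test channel: a Bernoulli(`β`) reproduction through a binary symmetric channel with
crossover `ρ` yields the Bernoulli(`τ`) source. -/
theorem exists_mem_Icc_mixture {ρ τ : ℝ} (h1 : ρ ≤ τ) (h2 : ρ ≤ 1 - τ) :
    ∃ β ∈ Icc (0 : ℝ) 1, τ = β * (1 - ρ) + (1 - β) * ρ := by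
  rcases eq_or_lt_of_le (show ρ ≤ 1 / 2 by linarith) with h | h
  · exact ⟨0, by simp, by linarith⟩
  · have hpos : 0 < 1 - 2 * ρ := by linarith
    refine ⟨(τ - ρ) / (1 - 2 * ρ), ⟨by apply div_nonneg <;> linarith, ?_⟩, ?_⟩
    · rw [div_le_one hpos]; linarith
    · rw [← sub_eq_zero]
      have hne := hpos.ne'
      have e : (τ - ρ) / (1 - 2 * ρ) * (1 - 2 * ρ) = τ - ρ := div_mul_cancel₀ _ hne
      linarith

/-- Symmetry of mutual information for the test channel: the left side is the entropy of the
reproduction minus its conditional entropy given the source, the right side the same with roles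
exchanged. -/
theorem mixture_entropy_identity (β ρ τ : ℝ) (h : τ = β * (1 - ρ) + (1 - β) * ρ) :
    Real.binEntropy β -
      (Real.negMulLog ((1 - β) * ρ) + Real.negMulLog (τ - (1 - β) * ρ) - Real.negMulLog τ) -
      (Real.negMulLog (β * ρ) + Real.negMulLog (1 - τ - β * ρ) - Real.negMulLog (1 - τ)) =
    Real.binEntropy τ - Real.binEntropy ρ := by
  have e1 : τ - (1 - β) * ρ = β * (1 - ρ) := by rw [h]; ring
  have e2 : 1 - τ - β * ρ = (1 - β) * (1 - ρ) := by rw [h]; ring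
  rw [e1, e2]
  simp only [Real.negMulLog_mul, Real.binEntropy_eq_negMulLog_add_negMulLog_one_sub]
  ring

theorem tendsto_log_add_two_div :
    Tendsto (fun n : ℕ => Real.log ((n : ℝ) + 2) / (n : ℝ)) atTop (𝓝 0) := by
  have h2 : Tendsto (fun n : ℕ => Real.log 3 / (n : ℝ)) atTop (𝓝 0) :=
    tendsto_const_nhds.div_atTop tendsto_natCast_atTop_atTop
  have h3 := tendsto_log_natCast_add_one_div.add h2
  rw [add_zero] at h3
  refine tendsto_of_tendsto_of_tendsto_of_le_of_le' tendsto_const_nhds h3 ?_ ?_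
  · exact Eventually.of_forall fun n => div_nonneg (Real.log_nonneg (by
      have : (0:ℝ) ≤ n := by positivity
      linarith)) (by positivity)
  · filter_upwards [eventually_ge_atTop 1] with n hn
    have hn' : (1 : ℝ) ≤ n := by exact_mod_cast hn
    rw [← add_div]
    gcongr
    have : Real.log ((n : ℝ) + 2) ≤ Real.log (n * 3) :=
      Real.log_le_log (by linarith) (by linarith)
    rw [Real.log_mul (by positivity) (by norm_num)] at this
    linarith

theorem eventually_le_exp_of_tendsto_log_div {f : ℕ → ℝ} {L : ℝ}
    (hf : ∀ᶠ n in atTop, 0 < f n) (h : Tendsto (fun n : ℕ => Real.log (f n) / n) atTop (𝓝 L))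
    {M : ℝ} (hM : L < M) : ∀ᶠ n : ℕ in atTop, f n ≤ Real.exp (n * M) := by
  filter_upwards [hf, h.eventually_lt_const hM, eventually_gt_atTop 0] with n h1 h2 h3
  have h3' : (0 : ℝ) < n := by exact_mod_cast h3
  rw [div_lt_iff₀ h3'] at h2
  rw [← Real.log_le_iff_le_exp h1]
  linarith

theorem eventually_exp_le_of_tendsto_log_div {f : ℕ → ℝ} {L : ℝ}
    (hf : ∀ᶠ n in atTop, 0 < f n) (h : Tendsto (fun n : ℕ => Real.log (f n) / n) atTop (𝓝 L))
    {M : ℝ} (hM : M < L) : ∀ᶠ n : ℕ in atTop, Real.exp (n * M) ≤ f n := by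
  filter_upwards [hf, h.eventually_const_lt hM, eventually_gt_atTop 0] with n h1 h2 h3
  have h3' : (0 : ℝ) < n := by exact_mod_cast h3
  rw [lt_div_iff₀ h3'] at h2
  rw [← Real.le_log_iff_exp_le h1]
  linarith

/-- Layers of relative weight `τ` are covered with relative radius `δ - τ` at the rate given by
the rate-distortion function of a Bernoulli source under Hamming distortion. -/
theorem exists_coversLayer_asymptotic {k t : ℕ → ℕ} {τ δ : ℝ}
    (hk : Tendsto (fun n => (k n : ℝ) / n) atTop (𝓝 τ))
    (ht : Tendsto (fun n => (t n : ℝ) / n) atTop (𝓝 δ))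
    (hkn : ∀ᶠ n in atTop, k n ≤ n) (hkt : ∀ᶠ n in atTop, k n ≤ t n) :
    ∃ 𝓔 : ∀ n, Finset (Finset (Fin n)), (∀ᶠ n in atTop, CoversLayer (t n) (k n) (𝓔 n)) ∧
      ∀ M, Real.binEntropy τ - Real.binEntropy (min (δ - τ) (min τ (1 - τ))) < M →
        ∀ᶠ n : ℕ in atTop, ((𝓔 n).card : ℝ) ≤ Real.exp (n * M) := by
  set ρ := min (δ - τ) (min τ (1 - τ)) with hρ
  have hτ0 : 0 ≤ τ := ge_of_tendsto' hk fun n => by positivity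
  have hτ1 : τ ≤ 1 := by
    refine le_of_tendsto hk ?_
    filter_upwards [hkn] with n hn
    exact div_le_one_of_le₀ (by exact_mod_cast hn) (by positivity)
  have hτδ : τ ≤ δ := by
    refine le_of_tendsto_of_tendsto hk ht ?_
    filter_upwards [hkt] with n hn
    gcongr
  have hρ0 : 0 ≤ ρ := le_min (by linarith) (le_min hτ0 (by linarith))
  have hρr : ρ ≤ δ - τ := min_le_left _ _
  have hρτ : ρ ≤ τ := (min_le_right _ _).trans (min_le_left _ _)
  have hρτ' : ρ ≤ 1 - τ := (min_le_right _ _).trans (min_le_right _ _)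
  obtain ⟨β, ⟨hβ0, hβ1⟩, hβ⟩ := exists_mem_Icc_mixture hρτ hρτ'
  have hβ1' : 0 ≤ 1 - β := by linarith
  have hr : Tendsto (fun n => ((t n - k n : ℕ) : ℝ) / n) atTop (𝓝 (δ - τ)) := by
    refine (ht.sub hk).congr' ?_
    filter_upwards [hkt] with n h
    rw [Nat.cast_sub h, sub_div]
  have hone : Tendsto (fun n : ℕ => (n : ℝ) / n) atTop (𝓝 1) := by
    refine tendsto_const_nhds.congr' ?_
    filter_upwards [eventually_gt_atTop 0] with n hn
    field_simp
  have hnk : Tendsto (fun n => ((n - k n : ℕ) : ℝ) / n) atTop (𝓝 (1 - τ)) := by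
    refine (hone.sub hk).congr' ?_
    filter_upwards [hkn] with n h
    rw [Nat.cast_sub h, sub_div]
  have hfloor : ∀ x : ℝ, 0 ≤ x → Tendsto (fun n : ℕ => (⌊x * n⌋₊ : ℝ) / n) atTop (𝓝 x) :=
    fun x hx => (tendsto_nat_floor_mul_div_atTop hx).comp tendsto_natCast_atTop_atTop
  have hmin : ∀ {u v : ℕ → ℕ} {x y : ℝ}, Tendsto (fun n => (u n : ℝ) / n) atTop (𝓝 x) →
      Tendsto (fun n => (v n : ℝ) / n) atTop (𝓝 y) →
      Tendsto (fun n => ((min (u n) (v n) : ℕ) : ℝ) / n) atTop (𝓝 (min x y)) := by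
    intro u v x y hu hv
    refine (hu.min hv).congr fun n => ?_
    rw [Nat.cast_min, min_div_div_right (by positivity)]
  -- The test channel leaves a fraction `(1-β)ρ` of positions in `W \ E` and `βρ` in `E \ W`. The
  -- caps in `a` and `b` enforce the exact constraints `a ≤ k`, `b ≤ n - k`, `k + a + b ≤ t` without
  -- changing the limits.
  set a : ℕ → ℕ := fun n => min ⌊(1 - β) * ρ * n⌋₊ (min (k n) (t n - k n)) with ha
  have halim : Tendsto (fun n => (a n : ℝ) / n) atTop (𝓝 ((1 - β) * ρ)) := by
    have := hmin (hfloor ((1 - β) * ρ) (by positivity)) (hmin hk hr)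
    have e : min ((1 - β) * ρ) (min τ (δ - τ)) = (1 - β) * ρ := by
      apply min_eq_left
      have : (1 - β) * ρ ≤ ρ := by nlinarith
      exact le_min (by linarith) (by linarith)
    rwa [e] at this
  have hak : ∀ n, a n ≤ k n := fun n => (min_le_right _ _).trans (min_le_left _ _)
  have har : ∀ n, a n ≤ t n - k n := fun n => (min_le_right _ _).trans (min_le_right _ _)
  have hra : Tendsto (fun n => ((t n - k n - a n : ℕ) : ℝ) / n) atTop
      (𝓝 (δ - τ - (1 - β) * ρ)) := by
    refine (hr.sub halim).congr fun n => ?_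
    rw [Nat.cast_sub (har n), sub_div]
  set b : ℕ → ℕ := fun n => min ⌊β * ρ * n⌋₊ (min (n - k n) (t n - k n - a n)) with hb
  have hblim : Tendsto (fun n => (b n : ℝ) / n) atTop (𝓝 (β * ρ)) := by
    have := hmin (hfloor (β * ρ) (by positivity)) (hmin hnk hra)
    have e : min (β * ρ) (min (1 - τ) (δ - τ - (1 - β) * ρ)) = β * ρ := by
      apply min_eq_left
      have : β * ρ ≤ ρ := by nlinarith
      exact le_min (by linarith) (by linarith)
    rwa [e] at this
  have hbk : ∀ n, b n ≤ n - k n := fun n => (min_le_right _ _).trans (min_le_left _ _)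
  have hbr : ∀ n, b n ≤ t n - k n - a n := fun n => (min_le_right _ _).trans (min_le_right _ _)
  have hjlim : Tendsto (fun n => ((k n - a n + b n : ℕ) : ℝ) / n) atTop (𝓝 β) := by
    have := (hk.sub halim).add hblim
    have e : τ - (1 - β) * ρ + β * ρ = β := by linarith
    rw [e] at this
    refine this.congr fun n => ?_
    rw [Nat.cast_add, Nat.cast_sub (hak n)]
    ring
  have hex : ∀ n, ∃ 𝓔 : Finset (Finset (Fin n)), k n ≤ t n →
      (𝓔.card : ℝ) ≤ (n + 2) * (n.choose (k n - a n + b n) /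
        ((k n).choose (a n) * (n - k n).choose (b n))) ∧ CoversLayer (t n) (k n) 𝓔 := by
    intro n
    by_cases h : k n ≤ t n
    · obtain ⟨𝓔, h'⟩ := exists_coversLayer (n := n) (t := t n) (hak n) (hbk n)
        (by have := har n; have := hbr n; omega)
      exact ⟨𝓔, fun _ => h'⟩
    · exact ⟨∅, fun h' => absurd h' h⟩
  choose 𝓔 h𝓔 using hex
  refine ⟨𝓔, by filter_upwards [hkt] with n hn using (h𝓔 n hn).2, fun M hM => ?_⟩
  have l1 := tendsto_log_choose_self hjlim (by
    filter_upwards [hkn] with n hn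
    have := hak n; have := hbk n; omega)
  have l2 := tendsto_log_choose hk halim (by simp [hak]) hkn
  have l3 := tendsto_log_choose hnk hblim (by simp [hbk]) (by simp)
  have l4 := ((tendsto_log_add_two_div.add l1).sub l2).sub l3
  rw [zero_add, mixture_entropy_identity β ρ τ hβ] at l4
  have l5 : Tendsto (fun n : ℕ => Real.log ((n + 2) * (n.choose (k n - a n + b n) /
        ((k n).choose (a n) * (n - k n).choose (b n)) : ℝ)) / n) atTop
      (𝓝 (Real.binEntropy τ - Real.binEntropy ρ)) := by
    refine l4.congr' ?_
    filter_upwards [hkn] with n hn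
    have c1 : (0 : ℝ) < n.choose (k n - a n + b n) := by
      have := hak n; have := hbk n
      exact_mod_cast Nat.choose_pos (by omega)
    have c2 : (0 : ℝ) < (k n).choose (a n) := by exact_mod_cast Nat.choose_pos (hak n)
    have c3 : (0 : ℝ) < (n - k n).choose (b n) := by exact_mod_cast Nat.choose_pos (hbk n)
    rw [Real.log_mul (by positivity) (by positivity), Real.log_div (by positivity) (by positivity),
      Real.log_mul (by positivity) (by positivity)]
    ring
  filter_upwards [hkt, eventually_le_exp_of_tendsto_log_div (by
    filter_upwards [hkn] with n hn
    have c1 : (0 : ℝ) < n.choose (k n - a n + b n) := by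
      have := hak n; have := hbk n
      exact_mod_cast Nat.choose_pos (by omega)
    have c2 : (0 : ℝ) < (k n).choose (a n) := by exact_mod_cast Nat.choose_pos (hak n)
    have c3 : (0 : ℝ) < (n - k n).choose (b n) := by exact_mod_cast Nat.choose_pos (hbk n)
    positivity) l5 hM] with n h1 h2
  exact (h𝓔 n h1).1.trans h2

/-! ### From the channel to random error sets. -/

/-- The set of erased positions of an erasure pattern. -/
def erasedSet {n : ℕ} (x : ErasurePattern n) : Finset (Fin n) :=
  Finset.univ.filter fun i => x i = false

/-- The erasure pattern with a given set of erased positions. -/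
def patternOf {n : ℕ} (E : Finset (Fin n)) : ErasurePattern n := fun i => decide (i ∉ E)

theorem erasedSet_patternOf {n : ℕ} (E : Finset (Fin n)) : erasedSet (patternOf E) = E := by
  ext i
  simp [erasedSet, patternOf]

theorem image_erasedSet_image_patternOf {n : ℕ} (𝓔 : Finset (Finset (Fin n))) :
    (𝓔.image patternOf).image erasedSet = 𝓔 := by
  rw [Finset.image_image]
  simp [Function.comp_def, erasedSet_patternOf]

open Classical in
/-- Positions at which the received word differs from the transmitted one. -/
noncomputable def errorSet {A : Type*} {n : ℕ} (c r : Fin n → A) : Finset (Fin n) :=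
  Finset.univ.filter fun i => r i ≠ c i

theorem attemptSucceeds_iff {A : Type*} {n : ℕ} (K : ℕ) (c r : Fin n → A) (x : ErasurePattern n) :
    AttemptSucceeds K c r x ↔
      2 * (errorSet c r \ erasedSet x).card + (erasedSet x).card + K ≤ n := by
  have h : numErrors c r x = (errorSet c r \ erasedSet x).card := by
    unfold numErrors
    congr 1
    ext i
    simp [errorSet, erasedSet, and_comm]
  unfold AttemptSucceeds
  rw [h]
  change 2 * ((errorSet c r \ erasedSet x).card : ℤ) + ((erasedSet x).card : ℤ) < _ ↔ _
  omega

/-- Probability that the error set of a word of length `n` is `W`. -/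
noncomputable def errorWeight (p : ℝ) {n : ℕ} (W : Finset (Fin n)) : ℝ :=
  (1 - p) ^ W.card * p ^ (n - W.card)

theorem errorWeight_nonneg {p : ℝ} (hp0 : 0 ≤ p) (hp1 : p ≤ 1) {n : ℕ} (W : Finset (Fin n)) :
    0 ≤ errorWeight p W := by
  have : 0 ≤ 1 - p := by linarith
  unfold errorWeight
  positivity

theorem sum_errorWeight (p : ℝ) (n : ℕ) : ∑ W : Finset (Fin n), errorWeight p W = 1 := by
  unfold errorWeight
  rw [Fin.sum_pow_mul_eq_add_pow]
  simp

/-- Probability that no erased set in `𝓔` leads to success. -/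
noncomputable def erasureFailure (p : ℝ) {n : ℕ} (K : ℕ) (𝓔 : Finset (Finset (Fin n))) : ℝ :=
  ∑ W : Finset (Fin n) with ¬ ∃ E ∈ 𝓔, 2 * (W \ E).card + E.card + K ≤ n, errorWeight p W

open Classical in
-- Received words with error set `W` form a product set. Each position in `W` has `m - 1` wrong
-- symbols of total probability `1 - p`, so the alphabet size cancels.
theorem sum_mSC_errorSet_eq {A : Type*} [Fintype A] (hA : 2 ≤ Fintype.card A) (p : ℝ) {n : ℕ}
    (c : Fin n → A) (W : Finset (Fin n)) :
    ∑ r : Fin n → A with errorSet c r = W, ∏ i, mSC p (c i) (r i) = errorWeight p W := by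
  have hset : (Finset.univ.filter fun r : Fin n → A => errorSet c r = W) =
      Fintype.piFinset fun i => if i ∈ W then Finset.univ.erase (c i) else {c i} := by
    ext r
    simp only [Finset.mem_filter, Finset.mem_univ, true_and, Fintype.mem_piFinset, errorSet,
      Finset.ext_iff]
    refine forall_congr' fun i => ?_
    by_cases hi : i ∈ W <;> simp [hi]
  have hm : ((Fintype.card A : ℝ) - 1) ≠ 0 := by
    have : (2 : ℝ) ≤ Fintype.card A := by exact_mod_cast hA
    linarith
  rw [hset, ← Finset.prod_univ_sum]
  have hfac : ∀ i, ∑ a ∈ (if i ∈ W then Finset.univ.erase (c i) else {c i}), mSC p (c i) a =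
      if i ∈ W then 1 - p else p := by
    intro i
    by_cases hi : i ∈ W
    · simp only [hi, if_true]
      rw [Finset.sum_congr rfl (g := fun _ => (1 - p) / ((Fintype.card A : ℝ) - 1))]
      · rw [Finset.sum_const, Finset.card_erase_of_mem (Finset.mem_univ _), Finset.card_univ,
          nsmul_eq_mul, Nat.cast_sub (by omega)]
        field_simp
        push_cast
        ring
      · intro a ha
        simp [mSC, (Finset.mem_erase.1 ha).1]
    · simp [hi, mSC]
  rw [Finset.prod_congr rfl fun i _ => hfac i, Finset.prod_ite, Finset.prod_const,
    Finset.prod_const]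
  have h1 : (Finset.univ.filter fun i => i ∈ W) = W := by ext; simp
  have h2 : (Finset.univ.filter fun i => i ∉ W) = Wᶜ := by ext; simp
  rw [h1, h2, Finset.card_compl, Fintype.card_fin, errorWeight]

theorem failureProb_eq {A : Type*} [Fintype A] (hA : 2 ≤ Fintype.card A) (p : ℝ) {n : ℕ} (K : ℕ)
    (B : Finset (ErasurePattern n)) (c : Fin n → A) :
    failureProb p K B c = erasureFailure p K (B.image erasedSet) := by
  classical
  unfold failureProb erasureFailure
  rw [← Finset.sum_fiberwise (s := Finset.univ) (g := errorSet c), Finset.sum_filter]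
  refine Finset.sum_congr rfl fun W _ => ?_
  have hcond : ∀ r : Fin n → A, errorSet c r = W →
      ((∃ x ∈ B, AttemptSucceeds K c r x) ↔
        ∃ E ∈ B.image erasedSet, 2 * (W \ E).card + E.card + K ≤ n) := by
    rintro r rfl
    simp [attemptSucceeds_iff]
  by_cases h : ∃ E ∈ B.image erasedSet, 2 * (W \ E).card + E.card + K ≤ n
  · rw [if_neg (not_not.2 h)]
    refine Finset.sum_eq_zero fun r hr => ?_
    rw [if_pos ((hcond r (Finset.mem_filter.1 hr).2).2 h)]
  · rw [if_pos h, ← sum_mSC_errorSet_eq hA p c W]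
    refine Finset.sum_congr rfl fun r hr => ?_
    rw [if_neg (fun h' => h ((hcond r (Finset.mem_filter.1 hr).2).1 h'))]

theorem erasureFailure_nonneg {p : ℝ} (hp0 : 0 ≤ p) (hp1 : p ≤ 1) {n : ℕ} (K : ℕ)
    (𝓔 : Finset (Finset (Fin n))) : 0 ≤ erasureFailure p K 𝓔 :=
  Finset.sum_nonneg fun W _ => errorWeight_nonneg hp0 hp1 W

theorem erasureFailure_le_one {p : ℝ} (hp0 : 0 ≤ p) (hp1 : p ≤ 1) {n : ℕ} (K : ℕ)
    (𝓔 : Finset (Finset (Fin n))) : erasureFailure p K 𝓔 ≤ 1 := by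
  rw [← sum_errorWeight p n]
  exact Finset.sum_le_sum_of_subset_of_nonneg (Finset.filter_subset _ _)
    fun W _ _ => errorWeight_nonneg hp0 hp1 W

/-- Covering one layer bounds the failure probability by the probability of heavier errors. -/
theorem erasureFailure_le_of_coversLayer {p : ℝ} (hp0 : 0 ≤ p) (hp1 : p ≤ 1) {n K k : ℕ}
    (hK : K ≤ n) (hk : k ≤ n) {𝓔 : Finset (Finset (Fin n))} (h : CoversLayer (n - K) k 𝓔) :
    erasureFailure p K 𝓔 ≤ ∑ W : Finset (Fin n) with k < W.card, errorWeight p W := by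
  refine Finset.sum_le_sum_of_subset_of_nonneg (fun W hW => ?_)
    fun W _ _ => errorWeight_nonneg hp0 hp1 W
  simp only [Finset.mem_filter, Finset.mem_univ, true_and] at hW ⊢
  by_contra hle
  obtain ⟨E, hE, hc⟩ := h.exists_of_card_le hk W (not_lt.1 hle)
  exact hW ⟨E, hE, by omega⟩

/-! ### Tail bounds for the number of errors. -/

/-- Binary relative entropy (in nats) of error rate `τ` with respect to error rate `1 - p`. -/
noncomputable def errorExponent (p τ : ℝ) : ℝ :=
  -Real.binEntropy τ - τ * Real.log (1 - p) - (1 - τ) * Real.log p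

/-- Chernoff bound for the number of errors. -/
theorem sum_errorWeight_le_exp {p τ : ℝ} (hp0 : 0 < p) (hp1 : p < 1) (h1 : 1 - p ≤ τ)
    (h2 : τ < 1) (n : ℕ) :
    ∑ W : Finset (Fin n) with τ * n ≤ W.card, errorWeight p W ≤
      Real.exp (-(n * errorExponent p τ)) := by
  have hq : 0 < 1 - p := by linarith
  have hτ : 0 < τ := by linarith
  have hτ1 : 0 < 1 - τ := by linarith
  -- The optimal exponential tilt: weighting each error by `s` moves the mean error rate from `1 -
  -- p` to `τ`.
  set s := τ * p / ((1 - τ) * (1 - p)) with hs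
  have hs1 : 1 ≤ s := by
    rw [hs, one_le_div (by positivity)]
    nlinarith
  have hs0 : 0 < s := by linarith
  have hlogs : Real.log s = Real.log τ + Real.log p - (Real.log (1 - τ) + Real.log (1 - p)) := by
    rw [hs, Real.log_div (by positivity) (by positivity), Real.log_mul hτ.ne' hp0.ne',
      Real.log_mul hτ1.ne' hq.ne']
  have hsum : (1 - p) * s + p = p / (1 - τ) := by
    rw [hs]; field_simp; ring
  have hlogsum : Real.log ((1 - p) * s + p) = Real.log p - Real.log (1 - τ) := by
    rw [hsum, Real.log_div hp0.ne' hτ1.ne']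
  calc ∑ W : Finset (Fin n) with τ * n ≤ W.card, errorWeight p W
      ≤ ∑ W : Finset (Fin n) with τ * n ≤ W.card,
          errorWeight p W * (s ^ W.card * Real.exp (-(τ * n * Real.log s))) := by
        refine Finset.sum_le_sum fun W hW => ?_
        refine le_mul_of_one_le_right (errorWeight_nonneg hp0.le hp1.le W) ?_
        have hW := (Finset.mem_filter.1 hW).2
        have : s ^ W.card = Real.exp (W.card * Real.log s) := by
          rw [Real.exp_nat_mul, Real.exp_log hs0]
        rw [this, ← Real.exp_add, Real.one_le_exp_iff]
        have := Real.log_nonneg hs1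
        nlinarith
    _ ≤ ∑ W : Finset (Fin n),
          errorWeight p W * (s ^ W.card * Real.exp (-(τ * n * Real.log s))) :=
        Finset.sum_le_sum_of_subset_of_nonneg (Finset.filter_subset _ _) fun W _ _ =>
          mul_nonneg (errorWeight_nonneg hp0.le hp1.le W) (by positivity)
    _ = ((1 - p) * s + p) ^ n * Real.exp (-(τ * n * Real.log s)) := by
        rw [← Fin.sum_pow_mul_eq_add_pow, Finset.sum_mul]
        refine Finset.sum_congr rfl fun W _ => ?_
        rw [errorWeight, mul_pow]
        ring
    _ = Real.exp (-(n * errorExponent p τ)) := by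
        have hpos : 0 < (1 - p) * s + p := by positivity
        have : ((1 - p) * s + p) ^ n = Real.exp (n * Real.log ((1 - p) * s + p)) := by
          rw [Real.exp_nat_mul, Real.exp_log hpos]
        rw [this, ← Real.exp_add, hlogsum, hlogs, errorExponent,
          Real.binEntropy_eq_negMulLog_add_negMulLog_one_sub, Real.negMulLog, Real.negMulLog]
        congr 1
        ring

/-- The binomial variance, read off from the variance identity for Bernstein polynomials at `1 - p`,
rescaled by `n ^ 2`. -/
theorem sum_errorWeight_mul_sq {p : ℝ} (hp0 : 0 < p) (hp1 : p < 1) {n : ℕ} (hn : n ≠ 0) :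
    ∑ W : Finset (Fin n), errorWeight p W * ((W.card : ℝ) - (1 - p) * n) ^ 2 =
      n * ((1 - p) * p) := by
  have hn' : (n : ℝ) ≠ 0 := by exact_mod_cast hn
  have hv := bernstein.variance hn (⟨1 - p, by constructor <;> linarith⟩ : unitInterval)
  have hs := Finset.sum_powerset_apply_card
    (fun k => (1 - p) ^ k * p ^ (n - k) * ((k : ℝ) - (1 - p) * n) ^ 2)
    (x := (Finset.univ : Finset (Fin n)))
  rw [Finset.powerset_univ, Finset.card_univ, Fintype.card_fin, Finset.sum_range] at hs
  unfold errorWeight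
  rw [hs]
  have : ∀ k : Fin (n + 1), n.choose k • ((1 - p) ^ (k : ℕ) * p ^ (n - (k : ℕ)) *
      (((k : ℕ) : ℝ) - (1 - p) * n) ^ 2) = n ^ 2 * (((⟨1 - p, by constructor <;> linarith⟩ :
        unitInterval) - bernstein.z k : ℝ) ^ 2 *
        bernstein n k ⟨1 - p, by constructor <;> linarith⟩) := by
    intro k
    rw [bernstein_apply]
    simp only [bernstein.z, nsmul_eq_mul, sub_sub_cancel]
    field_simp
    ring
  rw [Finset.sum_congr rfl fun k _ => this k, ← Finset.mul_sum, hv]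
  simp only [sub_sub_cancel]
  field_simp

/-- Chebyshev bound for the number of errors. -/
theorem sum_errorWeight_deviation_le {p : ℝ} (hp0 : 0 < p) (hp1 : p < 1) {n : ℕ} (hn : n ≠ 0)
    {l : ℝ} (hl : 0 < l) :
    ∑ W : Finset (Fin n) with l ≤ ((W.card : ℝ) - (1 - p) * n) ^ 2, errorWeight p W ≤
      n / l := by
  rw [le_div_iff₀ hl, Finset.sum_mul]
  calc ∑ W : Finset (Fin n) with l ≤ ((W.card : ℝ) - (1 - p) * n) ^ 2, errorWeight p W * l
      ≤ ∑ W : Finset (Fin n) with l ≤ ((W.card : ℝ) - (1 - p) * n) ^ 2,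
          errorWeight p W * ((W.card : ℝ) - (1 - p) * n) ^ 2 := by
        refine Finset.sum_le_sum fun W hW => ?_
        exact mul_le_mul_of_nonneg_left (Finset.mem_filter.1 hW).2
          (errorWeight_nonneg hp0.le hp1.le W)
    _ ≤ ∑ W : Finset (Fin n), errorWeight p W * ((W.card : ℝ) - (1 - p) * n) ^ 2 :=
        Finset.sum_le_sum_of_subset_of_nonneg (Finset.filter_subset _ _) fun W _ _ =>
          mul_nonneg (errorWeight_nonneg hp0.le hp1.le W) (by positivity)
    _ = n * ((1 - p) * p) := sum_errorWeight_mul_sq hp0 hp1 hn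
    _ ≤ n := by
        have : (1 - p) * p ≤ 1 := by nlinarith
        exact mul_le_of_le_one_right (by positivity) this

/-! ### Converse: volume bound and layers that must be covered. -/

theorem choose_le_choose_of_le_half {n i r : ℕ} (hir : i ≤ r) (hr : 2 * r ≤ n) :
    n.choose i ≤ n.choose r := by
  induction r, hir using Nat.le_induction with
  | base => exact le_rfl
  | succ r hir ih =>
    exact (ih (by omega)).trans (Nat.choose_le_succ_of_lt_half_left (by omega))

theorem card_filter_card_le {n r : ℕ} (hr : 2 * r ≤ n) :
    (Finset.univ.filter fun S : Finset (Fin n) => S.card ≤ r).card ≤ (n + 1) * n.choose r := by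
  have hsub : (Finset.univ.filter fun S : Finset (Fin n) => S.card ≤ r) ⊆
      (Finset.range (r + 1)).biUnion fun i => Finset.powersetCard i Finset.univ := by
    intro S hS
    have := (Finset.mem_filter.1 hS).2
    simp only [Finset.mem_biUnion, Finset.mem_range, Finset.mem_powersetCard, Finset.subset_univ,
      true_and]
    exact ⟨_, by omega, rfl⟩
  calc _ ≤ _ := Finset.card_le_card hsub
    _ ≤ (Finset.range (r + 1)).card * n.choose r := by
        refine Finset.card_biUnion_le_card_mul _ _ _ fun i hi => ?_
        rw [Finset.card_powersetCard, Finset.card_univ, Fintype.card_fin]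
        exact choose_le_choose_of_le_half (by have := Finset.mem_range.1 hi; omega) hr
    _ ≤ _ := by
        rw [Finset.card_range]
        gcongr
        omega

/-- Volume bound: one erased set serves few error sets of a given weight. -/
theorem card_covered_layer_le {n t k : ℕ} (hr : 2 * (t - k) ≤ n) (𝓔 : Finset (Finset (Fin n))) :
    (Finset.univ.filter fun W : Finset (Fin n) =>
      W.card = k ∧ ∃ E ∈ 𝓔, 2 * (W \ E).card + E.card ≤ t).card ≤
        𝓔.card * ((n + 1) * n.choose (t - k)) := by
  have hsub : (Finset.univ.filter fun W : Finset (Fin n) =>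
      W.card = k ∧ ∃ E ∈ 𝓔, 2 * (W \ E).card + E.card ≤ t) ⊆
      𝓔.biUnion fun E => Finset.univ.filter fun W : Finset (Fin n) =>
        W.card = k ∧ 2 * (W \ E).card + E.card ≤ t := by
    intro W hW
    simp only [Finset.mem_filter, Finset.mem_univ, true_and, Finset.mem_biUnion] at hW ⊢
    obtain ⟨h, E, hE, hle⟩ := hW
    exact ⟨E, hE, h, hle⟩
  refine (Finset.card_le_card hsub).trans (Finset.card_biUnion_le_card_mul _ _ _ fun E _ => ?_)
  refine le_trans ?_ (card_filter_card_le hr)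
  -- Translation by `E` embeds the error sets of weight `k` served by `E` into the ball of radius `t
  -- - k` about `∅`.
  refine Finset.card_le_card_of_injOn (fun W => symmDiff W E) ?_
    ((symmDiff_left_injective E).injOn)
  intro W hW
  simp only [Finset.coe_filter, Finset.mem_univ, true_and, Set.mem_ofPred_eq] at hW ⊢
  have h1 := two_mul_card_sdiff_add_card W E
  have h2 : (symmDiff W E).card ≤ (W \ E).card + (E \ W).card := by
    rw [symmDiff_def]
    exact Finset.card_union_le _ _
  omega

/-- Covering half of a layer of relative weight `τ` needs rate at least `H(τ) - H(δ - τ)`. -/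
theorem entropy_sub_le_of_half_covered {k t : ℕ → ℕ} {τ δ R : ℝ}
    {𝓔 : ∀ n, Finset (Finset (Fin n))}
    (hk : Tendsto (fun n => (k n : ℝ) / n) atTop (𝓝 τ))
    (ht : Tendsto (fun n => (t n : ℝ) / n) atTop (𝓝 δ))
    (hkn : ∀ᶠ n in atTop, k n ≤ n) (hτδ : τ < δ) (h2 : δ - τ < 1 / 2)
    (hcov : ∀ᶠ n in atTop, n.choose (k n) ≤ 2 * (Finset.univ.filter fun W : Finset (Fin n) =>
      W.card = k n ∧ ∃ E ∈ 𝓔 n, 2 * (W \ E).card + E.card ≤ t n).card)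
    (hrate : ∀ M, R < M → ∀ᶠ n : ℕ in atTop, ((𝓔 n).card : ℝ) ≤ Real.exp (n * M)) :
    Real.binEntropy τ - Real.binEntropy (δ - τ) ≤ R := by
  have hkt : ∀ᶠ n in atTop, k n ≤ t n := by
    filter_upwards [hk.eventually_lt ht hτδ, eventually_gt_atTop 0] with n hn h0
    have h0' : (0 : ℝ) < n := by exact_mod_cast h0
    exact_mod_cast ((div_lt_div_iff_of_pos_right h0').1 hn).le
  have hr : Tendsto (fun n => ((t n - k n : ℕ) : ℝ) / n) atTop (𝓝 (δ - τ)) := by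
    refine (ht.sub hk).congr' ?_
    filter_upwards [hkt] with n h
    rw [Nat.cast_sub h, sub_div]
  have hrn : ∀ᶠ n in atTop, 2 * (t n - k n) ≤ n := by
    filter_upwards [hr.eventually_lt_const h2, eventually_gt_atTop 0] with n hn h0
    have h0' : (0 : ℝ) < n := by exact_mod_cast h0
    rw [div_lt_iff₀ h0'] at hn
    have : (2 : ℝ) * ((t n - k n : ℕ) : ℝ) ≤ n := by linarith
    exact_mod_cast this
  refine le_of_forall_gt_imp_ge_of_dense fun M hM => ?_
  have l1 := tendsto_log_choose_self hk hkn
  have l2 := tendsto_log_choose_self hr (by filter_upwards [hrn] with n hn; omega)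
  have l3 : Tendsto (fun n : ℕ => M + 2 * (Real.log ((n : ℝ) + 2) / n) +
      Real.log (n.choose (t n - k n) : ℝ) / n) atTop
      (𝓝 (M + 2 * 0 + Real.binEntropy (δ - τ))) :=
    (tendsto_const_nhds.add (tendsto_log_add_two_div.const_mul 2)).add l2
  have hle := le_of_tendsto_of_tendsto l1 l3 (by
    filter_upwards [hkn, hcov, hrate M hM, hrn, eventually_gt_atTop 0] with n h1 h2 h3 h4 h5
    have h5' : (0 : ℝ) < n := by exact_mod_cast h5
    have c1 : (0 : ℝ) < n.choose (k n) := by exact_mod_cast Nat.choose_pos h1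
    have c2 : (0 : ℝ) < n.choose (t n - k n) := by exact_mod_cast Nat.choose_pos (by omega)
    have h6 : n.choose (k n) ≤ 2 * ((𝓔 n).card * ((n + 1) * n.choose (t n - k n))) :=
      h2.trans (Nat.mul_le_mul_left 2 (card_covered_layer_le h4 (𝓔 n)))
    have h7 : (n.choose (k n) : ℝ) ≤
        2 * ((𝓔 n).card * ((n + 1) * n.choose (t n - k n))) := by exact_mod_cast h6
    have h8 : (n.choose (k n) : ℝ) ≤
        Real.exp (n * M) * ((n + 2) ^ 2 * n.choose (t n - k n)) := by
      calc (n.choose (k n) : ℝ) ≤ 2 * ((𝓔 n).card * ((n + 1) * n.choose (t n - k n))) := h7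
        _ ≤ 2 * (Real.exp (n * M) * ((n + 1) * n.choose (t n - k n))) := by gcongr
        _ = Real.exp (n * M) * ((2 * (n + 1)) * n.choose (t n - k n)) := by ring
        _ ≤ _ := by gcongr; nlinarith
    have h9 := Real.log_le_log c1 h8
    rw [Real.log_mul (by positivity) (by positivity), Real.log_mul (by positivity) (by positivity),
      Real.log_exp, Real.log_pow] at h9
    push_cast at h9
    calc _ ≤ (n * M + (2 * Real.log (n + 2) + Real.log (n.choose (t n - k n) : ℝ))) / n := by
          gcongr
      _ = _ := by field_simp; ring)
  linarith

/-- If the failure probability is below half the probability of a range of error weights, then at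
least half of some layer in this range is covered. -/
theorem exists_half_covered {p : ℝ} (hp0 : 0 ≤ p) (hp1 : p ≤ 1) {n K : ℕ}
    (𝓔 : Finset (Finset (Fin n))) (S : Set ℕ) [DecidablePred (· ∈ S)]
    (h : 2 * erasureFailure p K 𝓔 < ∑ W : Finset (Fin n) with W.card ∈ S, errorWeight p W) :
    ∃ k ∈ S, k ≤ n ∧ n.choose k ≤ 2 * (Finset.univ.filter fun W : Finset (Fin n) =>
      W.card = k ∧ ∃ E ∈ 𝓔, 2 * (W \ E).card + E.card + K ≤ n).card := by
  classical
  by_contra! hcon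
  refine absurd h (not_lt.2 ?_)
  unfold erasureFailure
  have hmaps : ∀ (s : Finset (Finset (Fin n))), ∀ W ∈ s, W.card ∈ Finset.range (n + 1) := by
    intro s W _
    have := W.card_le_univ
    rw [Fintype.card_fin] at this
    simpa [Nat.lt_succ_iff] using this
  rw [← Finset.sum_fiberwise_of_maps_to (hmaps _),
    ← Finset.sum_fiberwise_of_maps_to (hmaps (Finset.univ.filter fun W : Finset (Fin n) =>
      ¬ ∃ E ∈ 𝓔, 2 * (W \ E).card + E.card + K ≤ n)), Finset.mul_sum]
  refine Finset.sum_le_sum fun k hk => ?_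
  have hkn : k ≤ n := by have := Finset.mem_range.1 hk; omega
  rw [Finset.filter_filter, Finset.filter_filter]
  -- Probability is constant on a layer, so layers can be compared by counting: if each layer in `S`
  -- were less than half covered, failure would carry at least half the mass of `S`.
  have hw : ∀ P : Finset (Fin n) → Prop, [DecidablePred P] →
      ∑ W : Finset (Fin n) with P W ∧ W.card = k, errorWeight p W =
      (Finset.univ.filter fun W : Finset (Fin n) => P W ∧ W.card = k).card *
        ((1 - p) ^ k * p ^ (n - k)) := by
    intro P _
    rw [← nsmul_eq_mul, ← Finset.sum_const]
    refine Finset.sum_congr rfl fun W hW => ?_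
    rw [errorWeight, (Finset.mem_filter.1 hW).2.2]
  rw [hw (fun W => W.card ∈ S), hw fun W => ¬ ∃ E ∈ 𝓔, 2 * (W \ E).card + E.card + K ≤ n,
    ← mul_assoc (2 : ℝ)]
  have : 0 ≤ 1 - p := by linarith
  refine mul_le_mul_of_nonneg_right ?_ (by positivity)
  by_cases hS : k ∈ S
  · have h1 := hcon k hS hkn
    have h2 : (Finset.univ.filter fun W : Finset (Fin n) => W.card = k).card = n.choose k := by
      rw [← Finset.powerset_univ, ← Finset.powersetCard_eq_filter, Finset.card_powersetCard,
        Finset.card_univ, Fintype.card_fin]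
    have h3 := Finset.card_filter_add_card_filter_not
      (s := Finset.univ.filter fun W : Finset (Fin n) => W.card = k)
      (fun W => ∃ E ∈ 𝓔, 2 * (W \ E).card + E.card + K ≤ n)
    rw [Finset.filter_filter, Finset.filter_filter, h2] at h3
    have h4 : (Finset.univ.filter fun W : Finset (Fin n) => W.card ∈ S ∧ W.card = k).card ≤
        n.choose k := by
      rw [← h2]
      exact Finset.card_le_card fun W hW => by
        simp only [Finset.mem_filter, Finset.mem_univ, true_and] at hW ⊢
        exact hW.2
    have h5 : (Finset.univ.filter fun W : Finset (Fin n) =>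
        W.card = k ∧ ¬ ∃ E ∈ 𝓔, 2 * (W \ E).card + E.card + K ≤ n) =
        Finset.univ.filter fun W : Finset (Fin n) =>
        (¬ ∃ E ∈ 𝓔, 2 * (W \ E).card + E.card + K ≤ n) ∧ W.card = k := by
      ext W; simp [and_comm]
    rw [h5] at h3
    have h6 : (Finset.univ.filter fun W : Finset (Fin n) => W.card ∈ S ∧ W.card = k).card ≤
        2 * (Finset.univ.filter fun W : Finset (Fin n) =>
        (¬ ∃ E ∈ 𝓔, 2 * (W \ E).card + E.card + K ≤ n) ∧ W.card = k).card := by omega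
    exact_mod_cast h6
  · have : (Finset.univ.filter fun W : Finset (Fin n) => W.card ∈ S ∧ W.card = k) = ∅ := by
      rw [Finset.filter_eq_empty_iff]
      rintro W - ⟨h1, h2⟩
      exact hS (h2 ▸ h1)
    rw [this]
    simp

theorem filter_add_le_eq {n K k : ℕ} (hK : K ≤ n) (𝓔 : Finset (Finset (Fin n))) :
    (Finset.univ.filter fun W : Finset (Fin n) =>
      W.card = k ∧ ∃ E ∈ 𝓔, 2 * (W \ E).card + E.card + K ≤ n) =
    Finset.univ.filter fun W : Finset (Fin n) =>
      W.card = k ∧ ∃ E ∈ 𝓔, 2 * (W \ E).card + E.card ≤ n - K := by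
  refine Finset.filter_congr fun W _ => and_congr_right fun _ => exists_congr fun E =>
    and_congr_right fun _ => ?_
  omega

/-- Deviations of the number of errors by `n ^ (3/4)` are asymptotically negligible. -/
theorem tendsto_sum_errorWeight_deviation {p : ℝ} (hp0 : 0 < p) (hp1 : p < 1) :
    Tendsto (fun n : ℕ => ∑ W : Finset (Fin n) with
      n * √n ≤ ((W.card : ℝ) - (1 - p) * n) ^ 2, errorWeight p W) atTop (𝓝 0) := by
  have h : Tendsto (fun n : ℕ => 1 / √(n : ℝ)) atTop (𝓝 0) :=
    tendsto_const_nhds.div_atTop (Real.tendsto_sqrt_atTop.comp tendsto_natCast_atTop_atTop)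
  refine tendsto_of_tendsto_of_tendsto_of_le_of_le' tendsto_const_nhds h ?_ ?_
  · exact Eventually.of_forall fun n =>
      Finset.sum_nonneg fun W _ => errorWeight_nonneg hp0.le hp1.le W
  · filter_upwards [eventually_gt_atTop 0] with n hn
    have hn' : (0 : ℝ) < n := by exact_mod_cast hn
    refine (sum_errorWeight_deviation_le hp0 hp1 hn.ne' (by positivity)).trans (le_of_eq ?_)
    field_simp

theorem tendsto_of_sq_sub_le {p : ℝ} {k : ℕ → ℕ}
    (h : ∀ᶠ n : ℕ in atTop, ((k n : ℝ) - (1 - p) * n) ^ 2 ≤ n * √n) :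
    Tendsto (fun n => (k n : ℝ) / n) atTop (𝓝 (1 - p)) := by
  have h0 : Tendsto (fun n : ℕ => √(1 / √(n : ℝ))) atTop (𝓝 0) := by
    have := (tendsto_const_nhds (x := (1 : ℝ))).div_atTop
      (Real.tendsto_sqrt_atTop.comp tendsto_natCast_atTop_atTop)
    have h := (Real.continuous_sqrt.tendsto 0).comp this
    rw [Real.sqrt_zero] at h
    exact h
  rw [tendsto_iff_norm_sub_tendsto_zero]
  refine squeeze_zero' (Eventually.of_forall fun n => norm_nonneg _) ?_ h0
  filter_upwards [h, eventually_gt_atTop 0] with n hn h0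
  have h0' : (0 : ℝ) < n := by exact_mod_cast h0
  have h1 : 0 < √(n : ℝ) := Real.sqrt_pos.2 h0'
  rw [Real.norm_eq_abs]
  refine Real.abs_le_sqrt ?_
  have e : ((k n : ℝ) / n - (1 - p)) ^ 2 = ((k n : ℝ) - (1 - p) * n) ^ 2 / n ^ 2 := by
    field_simp
  rw [e, div_le_div_iff₀ (by positivity) h1]
  have h2 : √(n : ℝ) * √n = n := Real.mul_self_sqrt h0'.le
  nlinarith

/-- Rate needed for vanishing failure probability. -/
theorem entropy_sub_le_of_tendsto_zero {p δ R : ℝ} (hp0 : 0 < p) (hp1 : p < 1)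
    {K : ℕ → ℕ} (hKn : ∀ᶠ n in atTop, K n ≤ n)
    (ht : Tendsto (fun n => ((n - K n : ℕ) : ℝ) / n) atTop (𝓝 δ))
    {𝓔 : ∀ n, Finset (Finset (Fin n))}
    (hfail : Tendsto (fun n => erasureFailure p (K n) (𝓔 n)) atTop (𝓝 0))
    (hδ : 1 - p < δ) (h2 : δ - (1 - p) < 1 / 2)
    (hrate : ∀ M, R < M → ∀ᶠ n : ℕ in atTop, ((𝓔 n).card : ℝ) ≤ Real.exp (n * M)) :
    Real.binEntropy (1 - p) - Real.binEntropy (δ - (1 - p)) ≤ R := by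
  classical
  have hex : ∀ᶠ n : ℕ in atTop, ∃ k : ℕ, ((k : ℝ) - (1 - p) * n) ^ 2 < n * √n ∧ k ≤ n ∧
      n.choose k ≤ 2 * (Finset.univ.filter fun W : Finset (Fin n) =>
        W.card = k ∧ ∃ E ∈ 𝓔 n, 2 * (W \ E).card + E.card + K n ≤ n).card := by
    -- The typical weights carry mass above `3/4`, more than twice a failure probability below
    -- `1/4`.
    filter_upwards [hfail.eventually_lt_const (show (0 : ℝ) < 1 / 4 by norm_num),
      (tendsto_sum_errorWeight_deviation hp0 hp1).eventually_lt_const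
        (show (0 : ℝ) < 1 / 4 by norm_num)] with n h1 h2
    refine exists_half_covered hp0.le hp1.le (𝓔 n)
      {k : ℕ | ((k : ℝ) - (1 - p) * n) ^ 2 < n * √n} ?_
    have h3 := Finset.sum_filter_add_sum_filter_not Finset.univ
      (fun W : Finset (Fin n) => n * √n ≤ ((W.card : ℝ) - (1 - p) * n) ^ 2) (errorWeight p)
    rw [sum_errorWeight] at h3
    simp only [not_le] at h3
    simp only [Set.mem_ofPred_eq]
    linarith
  obtain ⟨k, hk⟩ := hex.choice
  refine entropy_sub_le_of_half_covered (k := k) (t := fun n => n - K n) (𝓔 := 𝓔)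
    (tendsto_of_sq_sub_le ?_) ht ?_ hδ h2 ?_ hrate
  · filter_upwards [hk] with n hn using hn.1.le
  · filter_upwards [hk] with n hn using hn.2.1
  · filter_upwards [hk, hKn] with n hn hK
    rw [← filter_add_le_eq hK]
    exact hn.2.2

/-- Rate needed for an error exponent beyond that of error rate `τ`. -/
theorem entropy_sub_le_of_exponent {p δ τ R M : ℝ} (hp0 : 0 < p) (hp1 : p < 1)
    {K : ℕ → ℕ} (hKn : ∀ᶠ n in atTop, K n ≤ n)
    (ht : Tendsto (fun n => ((n - K n : ℕ) : ℝ) / n) atTop (𝓝 δ))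
    {𝓔 : ∀ n, Finset (Finset (Fin n))}
    (hM : errorExponent p τ < M)
    (hfail : ∀ᶠ n : ℕ in atTop, erasureFailure p (K n) (𝓔 n) ≤ Real.exp (-(n * M)))
    (hτ0 : 0 ≤ τ) (hτ1 : τ ≤ 1) (hδ : τ < δ) (h2 : δ - τ < 1 / 2)
    (hrate : ∀ M, R < M → ∀ᶠ n : ℕ in atTop, ((𝓔 n).card : ℝ) ≤ Real.exp (n * M)) :
    Real.binEntropy τ - Real.binEntropy (δ - τ) ≤ R := by
  classical
  have hq : 0 < 1 - p := by linarith
  set k : ℕ → ℕ := fun n => ⌊τ * n⌋₊ with hkdef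
  have hk : Tendsto (fun n => (k n : ℝ) / n) atTop (𝓝 τ) :=
    (tendsto_nat_floor_mul_div_atTop hτ0).comp tendsto_natCast_atTop_atTop
  have hkn : ∀ n, k n ≤ n := fun n => by
    refine Nat.floor_le_of_le ?_
    have : (0 : ℝ) ≤ n := by positivity
    nlinarith
  have hlayer : ∀ n, ∑ W : Finset (Fin n) with W.card ∈ ({k n} : Set ℕ), errorWeight p W =
      n.choose (k n) * ((1 - p) ^ k n * p ^ (n - k n)) := by
    intro n
    have : (n.choose (k n) : ℝ) = ((Finset.univ.filter fun W : Finset (Fin n) =>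
        W.card ∈ ({k n} : Set ℕ)).card : ℝ) := by
      simp only [Set.mem_singleton_iff]
      rw [← Finset.powerset_univ, ← Finset.powersetCard_eq_filter, Finset.card_powersetCard,
        Finset.card_univ, Fintype.card_fin]
    rw [this, ← nsmul_eq_mul, ← Finset.sum_const]
    refine Finset.sum_congr rfl fun W hW => ?_
    rw [errorWeight, Set.mem_singleton_iff.1 (Finset.mem_filter.1 hW).2]
  have hlog : Tendsto (fun n : ℕ =>
      Real.log (n.choose (k n) * ((1 - p) ^ k n * p ^ (n - k n))) / n) atTop
      (𝓝 (-errorExponent p τ)) := by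
    have hone : Tendsto (fun n : ℕ => (n : ℝ) / n) atTop (𝓝 1) := by
      refine tendsto_const_nhds.congr' ?_
      filter_upwards [eventually_gt_atTop 0] with n hn
      field_simp
    have := ((tendsto_log_choose_self hk (by simp [hkn])).add (hk.mul_const (Real.log (1 - p)))).add
      ((hone.sub hk).mul_const (Real.log p))
    have e : -errorExponent p τ =
        Real.binEntropy τ + τ * Real.log (1 - p) + (1 - τ) * Real.log p := by
      unfold errorExponent; ring
    rw [e]
    refine this.congr fun n => ?_
    have c : (0 : ℝ) < n.choose (k n) := by exact_mod_cast Nat.choose_pos (hkn n)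
    rw [Real.log_mul c.ne' (by positivity), Real.log_mul (by positivity) (by positivity),
      Real.log_pow, Real.log_pow, Nat.cast_sub (hkn n)]
    ring
  -- The layer has mass at least `exp(-nM')` eventually; the gap `M - M'` absorbs the factor 2
  -- required for half covering.
  obtain ⟨M', hM', hM''⟩ := exists_between hM
  have hlow := eventually_exp_le_of_tendsto_log_div (by
    refine Eventually.of_forall fun n => ?_
    have c : (0 : ℝ) < n.choose (k n) := by exact_mod_cast Nat.choose_pos (hkn n)
    positivity) hlog (neg_lt_neg hM')
  have hbig : Tendsto (fun n : ℕ => (n : ℝ) * (M - M')) atTop atTop :=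
    tendsto_natCast_atTop_atTop.atTop_mul_const (by linarith)
  refine entropy_sub_le_of_half_covered (k := k) (t := fun n => n - K n) (𝓔 := 𝓔)
    hk ht (by simp [hkn]) hδ h2 ?_ hrate
  filter_upwards [hfail, hlow, hKn, hbig.eventually_gt_atTop 1] with n h1 h2 h3 h4
  rw [← filter_add_le_eq h3]
  obtain ⟨k', hk', -, h5⟩ := exists_half_covered (K := K n) hp0.le hp1.le (𝓔 n) {k n} (by
    rw [hlayer n]
    refine lt_of_lt_of_le ?_ h2
    have h6 : (2 : ℝ) < Real.exp (n * (M - M')) := by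
      linarith [Real.add_one_le_exp ((n : ℝ) * (M - M'))]
    calc 2 * erasureFailure p (K n) (𝓔 n) ≤ 2 * Real.exp (-(n * M)) := by gcongr
      _ < Real.exp (n * (M - M')) * Real.exp (-(n * M)) := by gcongr
      _ = Real.exp (n * -M') := by rw [← Real.exp_add]; ring_nf)
  rw [Set.mem_singleton_iff.1 hk'] at h5
  exact h5

/-! ### Monotonicity of the exponent and of the rate. -/

theorem errorExponent_continuous (p : ℝ) : Continuous (errorExponent p) := by
  unfold errorExponent
  fun_prop

theorem errorExponent_one_sub (p : ℝ) : errorExponent p (1 - p) = 0 := by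
  rw [errorExponent, Real.binEntropy_eq_negMulLog_add_negMulLog_one_sub, Real.negMulLog,
    Real.negMulLog]
  simp only [sub_sub_cancel]
  ring

theorem errorExponent_strictMonoOn {p : ℝ} (hp1 : p < 1) :
    StrictMonoOn (errorExponent p) (Icc (1 - p) 1) := by
  refine strictMonoOn_of_deriv_pos (convex_Icc _ _) (errorExponent_continuous p).continuousOn ?_
  intro τ hτ
  rw [interior_Icc] at hτ
  have h0 : 0 < 1 - p := by linarith
  have h1 : 0 < τ := h0.trans hτ.1
  have h2 : 0 < 1 - τ := by linarith [hτ.2]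
  have hd : HasDerivAt (errorExponent p)
      (-(Real.log (1 - τ) - Real.log τ) - 1 * Real.log (1 - p) - (-1) * Real.log p) τ := by
    unfold errorExponent
    exact (((Real.hasDerivAt_binEntropy h1.ne' (by linarith)).neg).sub
      ((hasDerivAt_id τ).mul_const _)).sub (((hasDerivAt_id τ).const_sub 1).mul_const _)
  rw [hd.deriv]
  have l1 : Real.log (1 - p) < Real.log τ := Real.log_lt_log h0 hτ.1
  have l2 : Real.log (1 - τ) < Real.log p := Real.log_lt_log h2 (by linarith [hτ.1])
  linarith

/-- Passes from the probability `u` of a correct symbol, in bits, to the error rate `1 - u`, in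
nats. The endpoints hold because `0 · log 0` evaluates to zero on both sides. -/
theorem klBits_eq {p u : ℝ} (hp0 : 0 < p) (hp1 : p < 1) (hu0 : 0 ≤ u) (hu1 : u ≤ 1) :
    klBits u p = errorExponent p (1 - u) / Real.log 2 := by
  have hq : 0 < 1 - p := by linarith
  have e : ∀ x y : ℝ, 0 ≤ x → 0 < y → x * Real.logb 2 (x / y) =
      (-Real.negMulLog x - x * Real.log y) / Real.log 2 := by
    intro x y hx hy
    rcases hx.eq_or_lt with rfl | hx
    · simp
    · rw [Real.logb, Real.log_div hx.ne' hy.ne', Real.negMulLog]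
      ring
  rw [klBits, e u p hu0 hp0, e (1 - u) (1 - p) (by linarith) hq, errorExponent,
    Real.binEntropy_one_sub, Real.binEntropy_eq_negMulLog_add_negMulLog_one_sub]
  ring

theorem klBits_bijOn {p δ : ℝ} (hp0 : 0 < p) (hp1 : p < 1) (hδ : 1 - p < δ) (hδ1 : δ ≤ 1) :
    BijOn (fun u => klBits u p) (Icc (1 - δ) p) (Icc 0 (klBits (1 - δ) p)) := by
  have hL : 0 < Real.log 2 := Real.log_pos one_lt_two
  have heq : EqOn (fun u => errorExponent p (1 - u) / Real.log 2) (fun u => klBits u p)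
      (Icc (1 - δ) p) := fun u hu =>
    (klBits_eq hp0 hp1 (by linarith [hu.1]) (by linarith [hu.2])).symm
  have hanti : StrictAntiOn (fun u => klBits u p) (Icc (1 - δ) p) := by
    refine StrictAntiOn.congr ?_ heq
    intro u hu v hv huv
    refine div_lt_div_of_pos_right ?_ hL
    exact errorExponent_strictMonoOn hp1 ⟨by linarith [hv.2], by linarith [hv.1]⟩
      ⟨by linarith [hu.2], by linarith [hu.1]⟩ (by linarith)
  have hcont : ContinuousOn (fun u => klBits u p) (Icc (1 - δ) p) := by
    refine ContinuousOn.congr ?_ heq.symm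
    have := errorExponent_continuous p
    fun_prop
  have hle : 1 - δ ≤ p := by linarith
  have hp : klBits p p = 0 := by
    rw [klBits_eq hp0 hp1 hp0.le hp1.le, errorExponent_one_sub, zero_div]
  refine ⟨fun u hu => ⟨?_, ?_⟩, hanti.injOn, ?_⟩
  · rw [← hp]
    exact hanti.antitoneOn hu (right_mem_Icc.2 hle) hu.2
  · exact hanti.antitoneOn (left_mem_Icc.2 hle) hu hu.1
  · have := intermediate_value_Icc' hle hcont
    simp only [hp] at this
    exact this

theorem binEntropy_le_binEntropy {x y : ℝ} (hx : 0 ≤ x) (hxy : x ≤ y) (hy : y ≤ 1 - x) :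
    Real.binEntropy x ≤ Real.binEntropy y := by
  rcases le_total y (2⁻¹ : ℝ) with h | h
  · exact Real.binEntropy_strictMonoOn.monotoneOn ⟨hx, hxy.trans h⟩ ⟨hx.trans hxy, h⟩ hxy
  · rw [← Real.binEntropy_one_sub y]
    have h' : 1 - y ≤ 2⁻¹ := by
      have : (2⁻¹ : ℝ) + 2⁻¹ = 1 := by norm_num
      linarith
    exact Real.binEntropy_strictMonoOn.monotoneOn ⟨hx, by linarith⟩ ⟨by linarith, h'⟩
      (by linarith)

/-- Source of the positive part: if `δ - τ ≤ τ` the distortion is not clipped, otherwise it is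
clipped to `τ` and the rate is zero. Symmetry and unimodality of the entropy give the matching
signs. -/
theorem binEntropy_sub_min_eq {τ δ : ℝ} (h0 : 0 ≤ τ) (h1 : τ ≤ δ) (h2 : δ ≤ 1) :
    Real.binEntropy τ - Real.binEntropy (min (δ - τ) (min τ (1 - τ))) =
      max 0 (Real.binEntropy τ - Real.binEntropy (δ - τ)) := by
  rcases le_or_gt (δ - τ) τ with h | h
  · rw [min_eq_left (le_min h (by linarith)), max_eq_right]
    exact sub_nonneg.2 (binEntropy_le_binEntropy (by linarith) h (by linarith))
  · have h3 : τ ≤ 1 - τ := by linarith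
    rw [min_eq_left h3, min_eq_right h.le, sub_self, max_eq_left]
    exact sub_nonpos.2 (binEntropy_le_binEntropy h0 h.le (by linarith))

/-- For `δ = 1` the function vanishes identically; hence the condition `D < N` for a cardinality
bound without slack. -/
theorem binEntropy_sub_strictMonoOn {δ : ℝ} (hδ1 : δ < 1) :
    StrictMonoOn (fun τ => Real.binEntropy τ - Real.binEntropy (δ - τ)) (Icc 0 δ) := by
  refine strictMonoOn_of_deriv_pos (convex_Icc _ _) (by fun_prop) ?_
  intro τ hτ
  rw [interior_Icc] at hτ
  have h1 : 0 < τ := hτ.1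
  have h2 : 0 < δ - τ := by linarith [hτ.2]
  have hd : HasDerivAt (fun τ => Real.binEntropy τ - Real.binEntropy (δ - τ))
      (Real.log (1 - τ) - Real.log τ -
        (Real.log (1 - (δ - τ)) - Real.log (δ - τ)) * (-1)) τ :=
    (Real.hasDerivAt_binEntropy h1.ne' (by linarith)).sub
      ((Real.hasDerivAt_binEntropy h2.ne' (by linarith)).comp τ ((hasDerivAt_id τ).const_sub δ))
  rw [hd.deriv]
  have l1 : Real.log (δ - τ) < Real.log (1 - τ) := Real.log_lt_log h2 (by linarith)
  have l2 : Real.log τ < Real.log (1 - (δ - τ)) := Real.log_lt_log h1 (by linarith)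
  linarith

/-! ### Achievability. -/

/-- Exponent of the failure probability when all layers of relative weight below `τ` are covered. -/
theorem erasureFailure_le_exp {p τ : ℝ} (hp0 : 0 < p) (hp1 : p < 1) (hτ : 1 - p < τ)
    (hτ1 : τ ≤ 1) {K : ℕ → ℕ} (hKn : ∀ᶠ n in atTop, K n ≤ n)
    {𝓔 : ∀ n, Finset (Finset (Fin n))}
    (hcov : ∀ σ, 1 - p < σ → σ < τ → ∀ᶠ n : ℕ in atTop,
      ∃ k ≤ n, σ * n ≤ k + 1 ∧ CoversLayer (n - K n) k (𝓔 n))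
    {M : ℝ} (hM : M < errorExponent p τ) :
    ∀ᶠ n : ℕ in atTop, erasureFailure p (K n) (𝓔 n) ≤ Real.exp (-(n * M)) := by
  -- Stepping back to `σ < τ` costs little exponent by continuity, and keeps `σ < 1` as the Chernoff
  -- bound requires even if `τ = 1`.
  have hev : ∀ᶠ σ in 𝓝[<] τ, M < errorExponent p σ :=
    ((errorExponent_continuous p).continuousWithinAt.tendsto).eventually_const_lt hM
  obtain ⟨σ, hσM, hσ0, hσ1⟩ := (hev.and (Ioo_mem_nhdsLT hτ)).exists
  filter_upwards [hKn, hcov σ hσ0 hσ1] with n h1 ⟨k, hk, hσk, hc⟩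
  calc erasureFailure p (K n) (𝓔 n)
      ≤ ∑ W : Finset (Fin n) with k < W.card, errorWeight p W :=
        erasureFailure_le_of_coversLayer hp0.le hp1.le h1 hk hc
    _ ≤ ∑ W : Finset (Fin n) with σ * n ≤ W.card, errorWeight p W := by
        refine Finset.sum_le_sum_of_subset_of_nonneg (fun W hW => ?_)
          fun W _ _ => errorWeight_nonneg hp0.le hp1.le W
        simp only [Finset.mem_filter, Finset.mem_univ, true_and] at hW ⊢
        have : ((k + 1 : ℕ) : ℝ) ≤ W.card := by exact_mod_cast hW
        push_cast at this
        linarith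
    _ ≤ Real.exp (-(n * errorExponent p σ)) :=
        sum_errorWeight_le_exp hp0 hp1 hσ0.le (hσ1.trans_le hτ1) n
    _ ≤ Real.exp (-(n * M)) := by gcongr

theorem tendsto_zero_of_le_exp {f : ℕ → ℝ} {M : ℝ} (hf : ∀ n, 0 ≤ f n) (hM : 0 < M)
    (h : ∀ᶠ n : ℕ in atTop, f n ≤ Real.exp (-(n * M))) : Tendsto f atTop (𝓝 0) := by
  refine squeeze_zero' (Eventually.of_forall hf) h ?_
  exact Real.tendsto_exp_neg_atTop_nhds_zero.comp
    (tendsto_natCast_atTop_atTop.atTop_mul_const hM)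

/-- Achievability of the rate `[H(τ) - H(δ - τ)]⁺` for the exponent of error rate `τ`. -/
theorem exists_erasedSets_of_rate {p τ δ : ℝ} (hp0 : 0 < p) (hp1 : p < 1) (hτ : 1 - p ≤ τ)
    (hqδ : 1 - p < δ) (hτδ : τ ≤ δ) (hδ1 : δ ≤ 1) {K : ℕ → ℕ} (hKn : ∀ᶠ n in atTop, K n ≤ n)
    (ht : Tendsto (fun n => ((n - K n : ℕ) : ℝ) / n) atTop (𝓝 δ)) :
    ∃ 𝓔 : ∀ n, Finset (Finset (Fin n)),
      (∀ M, max 0 (Real.binEntropy τ - Real.binEntropy (δ - τ)) < M →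
        ∀ᶠ n : ℕ in atTop, ((𝓔 n).card : ℝ) ≤ Real.exp (n * M)) ∧
      Tendsto (fun n => erasureFailure p (K n) (𝓔 n)) atTop (𝓝 0) ∧
      ∀ M < errorExponent p τ, ∀ᶠ n : ℕ in atTop,
        erasureFailure p (K n) (𝓔 n) ≤ Real.exp (-(n * M)) := by
  have hτ0 : 0 ≤ τ := by linarith
  have hw : Tendsto (fun n : ℕ => √(n * √n) / n) atTop (𝓝 0) := by
    have := (tendsto_const_nhds (x := (1 : ℝ))).div_atTop
      (Real.tendsto_sqrt_atTop.comp tendsto_natCast_atTop_atTop)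
    have h := (Real.continuous_sqrt.tendsto 0).comp this
    rw [Real.sqrt_zero] at h
    refine h.congr' ?_
    filter_upwards [eventually_gt_atTop 0] with n hn
    have hn' : (0 : ℝ) < n := by exact_mod_cast hn
    have h1 : 0 < √(n : ℝ) := Real.sqrt_pos.2 hn'
    have h2 : √(n : ℝ) * √n = n := Real.mul_self_sqrt hn'.le
    rw [eq_div_iff hn'.ne']
    simp only [Function.comp_apply]
    rw [show √(1 / √(n : ℝ)) * n = √(1 / √(n : ℝ)) * √(n ^ 2) by rw [Real.sqrt_sq hn'.le],
      ← Real.sqrt_mul (by positivity)]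
    congr 1
    field_simp
    nlinarith
  -- The margin `n^(3/4)` leaves `τ` unchanged in the limit but exceeds typical fluctuations, so
  -- failure still vanishes when `τ = 1 - p`.
  set x : ℕ → ℝ := fun n => τ * n + √(n * √n) with hx
  have hx0 : ∀ n, 0 ≤ x n := fun n => by positivity
  have hxlim : Tendsto (fun n : ℕ => x n / n) atTop (𝓝 τ) := by
    have : Tendsto (fun n : ℕ => τ + √(n * √n) / n) atTop (𝓝 (τ + 0)) :=
      tendsto_const_nhds.add hw
    rw [add_zero] at this
    refine this.congr' ?_
    filter_upwards [eventually_gt_atTop 0] with n hn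
    simp only [hx]
    field_simp
  have hfl : Tendsto (fun n : ℕ => (⌊x n⌋₊ : ℝ) / n) atTop (𝓝 τ) := by
    have h1 : Tendsto (fun n : ℕ => x n / n - 1 / (n : ℝ)) atTop (𝓝 (τ - 0)) :=
      hxlim.sub tendsto_one_div_atTop_nhds_zero_nat
    rw [sub_zero] at h1
    refine tendsto_of_tendsto_of_tendsto_of_le_of_le' h1 hxlim ?_ ?_
    · refine Eventually.of_forall fun n => ?_
      rw [← sub_div]
      gcongr
      linarith [Nat.lt_floor_add_one (x n)]
    · refine Eventually.of_forall fun n => ?_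
      gcongr
      exact Nat.floor_le (hx0 n)
  set k : ℕ → ℕ := fun n => min ⌊x n⌋₊ (n - K n) with hkdef
  have hk : Tendsto (fun n => (k n : ℝ) / n) atTop (𝓝 τ) := by
    have := hfl.min ht
    rw [min_eq_left hτδ] at this
    refine this.congr fun n => ?_
    rw [Nat.cast_min, min_div_div_right (by positivity)]
  have hkn : ∀ n, k n ≤ n := fun n => (min_le_right _ _).trans (Nat.sub_le _ _)
  obtain ⟨𝓔, hcov, hrate⟩ := exists_coversLayer_asymptotic hk ht (by simp [hkn])
    (by simp [hkdef])
  rw [binEntropy_sub_min_eq hτ0 hτδ hδ1] at hrate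
  refine ⟨𝓔, hrate, ?_⟩
  have hfloor : ∀ n, x n < ⌊x n⌋₊ + 1 := fun n => Nat.lt_floor_add_one _
  rcases hτ.eq_or_lt with hτq | hτq
  -- Here the exponent is zero and only the Chebyshev bound helps. The cap `n - K n` is eventually
  -- inactive because `1 - p < δ`.
  · have hbig : ∀ᶠ n : ℕ in atTop, x n ≤ k n + 1 := by
      filter_upwards [hxlim.eventually_lt ht (by linarith), eventually_gt_atTop 0] with n h1 h2
      have hn' : (0 : ℝ) < n := by exact_mod_cast h2
      have h3 := (div_lt_div_iff_of_pos_right hn').1 h1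
      simp only [hkdef]
      rcases min_choice ⌊x n⌋₊ (n - K n) with h | h <;> rw [h]
      · exact (hfloor n).le
      · linarith
    constructor
    · refine squeeze_zero' (Eventually.of_forall fun n => erasureFailure_nonneg hp0.le hp1.le _ _)
        ?_ (tendsto_sum_errorWeight_deviation hp0 hp1)
      filter_upwards [hKn, hcov, hbig] with n h1 h2 h3
      refine (erasureFailure_le_of_coversLayer hp0.le hp1.le h1 (hkn n) h2).trans ?_
      refine Finset.sum_le_sum_of_subset_of_nonneg (fun W hW => ?_)
        fun W _ _ => errorWeight_nonneg hp0.le hp1.le W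
      simp only [Finset.mem_filter, Finset.mem_univ, true_and] at hW ⊢
      have h4 : ((k n + 1 : ℕ) : ℝ) ≤ W.card := by exact_mod_cast hW
      push_cast at h4
      have h5 : √(n * √(n : ℝ)) ≤ (W.card : ℝ) - (1 - p) * n := by
        rw [hτq]
        simp only [hx] at h3
        linarith
      calc (n : ℝ) * √n = √(n * √(n : ℝ)) ^ 2 := (Real.sq_sqrt (by positivity)).symm
        _ ≤ _ := by gcongr
    · intro M hM
      rw [← hτq, errorExponent_one_sub] at hM
      refine Eventually.of_forall fun n => (erasureFailure_le_one hp0.le hp1.le _ _).trans ?_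
      rw [Real.one_le_exp_iff]
      have : (0 : ℝ) ≤ n := by positivity
      nlinarith
  · have hexp : ∀ M < errorExponent p τ, ∀ᶠ n : ℕ in atTop,
        erasureFailure p (K n) (𝓔 n) ≤ Real.exp (-(n * M)) := by
      intro M hM
      refine erasureFailure_le_exp hp0 hp1 hτq (hτδ.trans hδ1) hKn ?_ hM
      intro σ hσ0 hσ1
      filter_upwards [hcov, ht.eventually_const_lt (hσ1.trans_le hτδ), eventually_gt_atTop 0]
        with n h1 h2 h3
      refine ⟨k n, hkn n, ?_, h1⟩
      have hn' : (0 : ℝ) < n := by exact_mod_cast h3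
      simp only [hkdef]
      rcases min_choice ⌊x n⌋₊ (n - K n) with h | h <;> rw [h]
      · refine le_trans ?_ (hfloor n).le
        simp only [hx]
        have : 0 ≤ √(n * √(n : ℝ)) := Real.sqrt_nonneg _
        nlinarith
      · rw [lt_div_iff₀ hn'] at h2
        linarith
    have hpos : 0 < errorExponent p τ := by
      rw [← errorExponent_one_sub p]
      exact errorExponent_strictMonoOn hp1 ⟨le_rfl, by linarith⟩ ⟨hτ, hτδ.trans hδ1⟩ hτq
    exact ⟨tendsto_zero_of_le_exp (fun n => erasureFailure_nonneg hp0.le hp1.le _ _)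
      (half_pos hpos) (hexp _ (half_lt_self hpos)), hexp⟩

theorem coversLayer_singleton_empty {n t k : ℕ} (h : 2 * k ≤ t) :
    CoversLayer t k ({∅} : Finset (Finset (Fin n))) := by
  rintro W rfl
  exact ⟨∅, by simp, by simpa using h⟩

/-- Sets within a given cardinality bound that cover a layer of largest possible weight. -/
theorem exists_maximal_coversLayer (n t : ℕ) {C : ℝ} (hC : 0 ≤ C) :
    ∃ 𝓔 : Finset (Finset (Fin n)), (𝓔.card : ℝ) ≤ C ∧
      ∀ k ≤ n, (∃ 𝓔' : Finset (Finset (Fin n)), (𝓔'.card : ℝ) ≤ C ∧ CoversLayer t k 𝓔') →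
        ∃ k' ≤ n, k ≤ k' ∧ CoversLayer t k' 𝓔 := by
  classical
  by_cases h : ∃ k ≤ n, ∃ 𝓔' : Finset (Finset (Fin n)), (𝓔'.card : ℝ) ≤ C ∧ CoversLayer t k 𝓔'
  · obtain ⟨k, hkn, hk⟩ := h
    obtain ⟨𝓔, hcard, hcov⟩ := Nat.findGreatest_spec (P := fun k =>
      ∃ 𝓔' : Finset (Finset (Fin n)), (𝓔'.card : ℝ) ≤ C ∧ CoversLayer t k 𝓔') hkn hk
    exact ⟨𝓔, hcard, fun k hkn hk =>
      ⟨_, Nat.findGreatest_le n, Nat.le_findGreatest hkn hk, hcov⟩⟩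
  · exact ⟨∅, by simpa using hC, fun k hkn hk => absurd ⟨k, hkn, hk⟩ h⟩

/-- For a positive exponent and `δ < 1`, the optimal rate is attained without slack. -/
theorem exists_erasedSets_of_card_le {p τ δ : ℝ} (hp0 : 0 < p) (hp1 : p < 1) (hτ : 1 - p < τ)
    (hτδ : τ ≤ δ) (hδ1 : δ < 1) {K : ℕ → ℕ} (hKn : ∀ᶠ n in atTop, K n ≤ n)
    (ht : Tendsto (fun n => ((n - K n : ℕ) : ℝ) / n) atTop (𝓝 δ)) :
    ∃ 𝓔 : ∀ n, Finset (Finset (Fin n)),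
      (∀ n : ℕ, ((𝓔 n).card : ℝ) ≤
        Real.exp (n * max 0 (Real.binEntropy τ - Real.binEntropy (δ - τ)))) ∧
      Tendsto (fun n => erasureFailure p (K n) (𝓔 n)) atTop (𝓝 0) ∧
      ∀ M < errorExponent p τ, ∀ᶠ n : ℕ in atTop,
        erasureFailure p (K n) (𝓔 n) ≤ Real.exp (-(n * M)) := by
  set f := max 0 (Real.binEntropy τ - Real.binEntropy (δ - τ)) with hf
  -- The choice does not involve `σ`, so one sequence serves every `σ < τ` simultaneously.
  choose 𝓔 hcard hmax using fun n : ℕ =>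
    exists_maximal_coversLayer n (n - K n) (Real.exp_pos (n * f)).le
  have hG := binEntropy_sub_strictMonoOn hδ1
  have hτ0 : 0 ≤ τ := by linarith
  have hsmall : ∀ σ, 1 - p < σ → σ < τ → ∀ᶠ n : ℕ in atTop,
      ∃ 𝓔' : Finset (Finset (Fin n)), (𝓔'.card : ℝ) ≤ Real.exp (n * f) ∧
        CoversLayer (n - K n) ⌊σ * n⌋₊ 𝓔' := by
    intro σ hσ0 hσ1
    have hσ : 0 ≤ σ := by linarith
    have hk : Tendsto (fun n : ℕ => (⌊σ * n⌋₊ : ℝ) / n) atTop (𝓝 σ) :=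
      (tendsto_nat_floor_mul_div_atTop hσ).comp tendsto_natCast_atTop_atTop
    rcases le_or_gt τ (δ - τ) with h | h
    -- Since `σ < δ/2`, decoding without erasures already suffices.
    · filter_upwards [hk.eventually_lt (ht.div_const 2) (by linarith), eventually_gt_atTop 0]
        with n h1 h2
      have hn' : (0 : ℝ) < n := by exact_mod_cast h2
      refine ⟨{∅}, ?_, coversLayer_singleton_empty ?_⟩
      · have : (0 : ℝ) ≤ n * f := mul_nonneg hn'.le (le_max_left _ _)
        simpa using this
      · rw [div_right_comm] at h1
        have h3 := (div_lt_div_iff_of_pos_right hn').1 h1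
        have : (2 : ℝ) * ⌊σ * n⌋₊ ≤ ((n - K n : ℕ) : ℝ) := by linarith
        exact_mod_cast this
    · have hpos : 0 < Real.binEntropy τ - Real.binEntropy (δ - τ) := by
        -- The rate function vanishes at `δ/2 < τ`.
        have := hG (a := δ / 2) ⟨by linarith, by linarith⟩ ⟨hτ0, hτδ⟩ (by linarith)
        have e : δ - δ / 2 = δ / 2 := by ring
        simpa only [e, sub_self] using this
      have hlt : max 0 (Real.binEntropy σ - Real.binEntropy (δ - σ)) < f := by
        rw [hf, max_eq_right hpos.le]
        exact max_lt hpos (hG ⟨hσ, by linarith⟩ ⟨hτ0, hτδ⟩ hσ1)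
      have hkt : ∀ᶠ n : ℕ in atTop, ⌊σ * n⌋₊ ≤ n - K n := by
        filter_upwards [hk.eventually_lt ht (by linarith), eventually_gt_atTop 0] with n h1 h2
        have hn' : (0 : ℝ) < n := by exact_mod_cast h2
        exact_mod_cast ((div_lt_div_iff_of_pos_right hn').1 h1).le
      obtain ⟨𝓔', h1, h2⟩ := exists_coversLayer_asymptotic hk ht
        (by filter_upwards [hkt] with n hn; omega) hkt
      rw [binEntropy_sub_min_eq hσ (by linarith) hδ1.le] at h2
      filter_upwards [h1, h2 f hlt] with n h3 h4
      exact ⟨𝓔' n, h4, h3⟩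
  have hexp : ∀ M < errorExponent p τ, ∀ᶠ n : ℕ in atTop,
      erasureFailure p (K n) (𝓔 n) ≤ Real.exp (-(n * M)) := by
    intro M hM
    refine erasureFailure_le_exp hp0 hp1 hτ (hτδ.trans hδ1.le) hKn ?_ hM
    intro σ hσ0 hσ1
    filter_upwards [hsmall σ hσ0 hσ1] with n h1
    have hle : ⌊σ * n⌋₊ ≤ n := by
      refine Nat.floor_le_of_le ?_
      have : (0 : ℝ) ≤ n := by positivity
      nlinarith
    obtain ⟨k', hk'n, hk', hc⟩ := hmax n _ hle h1
    refine ⟨k', hk'n, (Nat.lt_floor_add_one (σ * n)).le.trans ?_, hc⟩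
    gcongr
  have hpos : 0 < errorExponent p τ := by
    rw [← errorExponent_one_sub p]
    exact errorExponent_strictMonoOn hp1 ⟨le_rfl, by linarith⟩
      ⟨hτ.le, hτδ.trans hδ1.le⟩ hτ
  exact ⟨𝓔, hcard, tendsto_zero_of_le_exp (fun n => erasureFailure_nonneg hp0.le hp1.le _ _)
    (half_pos hpos) (hexp _ (half_lt_self hpos)), hexp⟩

/-! ### Converse, and the theorem in bits. -/

/-- Converse: no smaller rate achieves the exponent of error rate `τ`. -/
theorem max_entropy_sub_le_rate {p τ δ R : ℝ} (hp0 : 0 < p) (hp1 : p < 1) (hτ : 1 - p ≤ τ)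
    (hqδ : 1 - p < δ) (hτδ : τ ≤ δ) (hδ1 : δ ≤ 1) {K : ℕ → ℕ} (hKn : ∀ᶠ n in atTop, K n ≤ n)
    (ht : Tendsto (fun n => ((n - K n : ℕ) : ℝ) / n) atTop (𝓝 δ))
    {𝓔 : ∀ n, Finset (Finset (Fin n))}
    (hrate : ∀ M, R < M → ∀ᶠ n : ℕ in atTop, ((𝓔 n).card : ℝ) ≤ Real.exp (n * M))
    (hfail : Tendsto (fun n => erasureFailure p (K n) (𝓔 n)) atTop (𝓝 0))
    (hexp : ∀ M < errorExponent p τ, ∀ᶠ n : ℕ in atTop,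
        erasureFailure p (K n) (𝓔 n) ≤ Real.exp (-(n * M))) :
    max 0 (Real.binEntropy τ - Real.binEntropy (δ - τ)) ≤ R := by
  have hτ0 : 0 ≤ τ := by linarith
  -- Failure probability below 1 forces at least one pattern.
  have hR : 0 ≤ R := by
    refine le_of_forall_gt_imp_ge_of_dense fun M hM => ?_
    obtain ⟨n, h1, h2, h3⟩ := ((hrate M hM).and ((hfail.eventually_lt_const zero_lt_one).and
      (eventually_gt_atTop 0))).exists
    have hn' : (0 : ℝ) < n := by exact_mod_cast h3
    have hne : 1 ≤ (𝓔 n).card := by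
      rw [Nat.one_le_iff_ne_zero]
      intro h0
      rw [Finset.card_eq_zero] at h0
      rw [h0] at h2
      simp [erasureFailure, sum_errorWeight] at h2
    have h4 : (1 : ℝ) ≤ Real.exp (n * M) := le_trans (by exact_mod_cast hne) h1
    rw [Real.one_le_exp_iff] at h4
    exact nonneg_of_mul_nonneg_right h4 hn'
  refine max_le hR ?_
  -- The volume bound needs a radius below `1/2`; beyond it, `δ ≤ 1` gives `τ ≤ δ - τ` and the
  -- entropy difference is nonpositive.
  rcases le_or_gt (1 / 2) (δ - τ) with h | h
  · have := binEntropy_le_binEntropy hτ0 (show τ ≤ δ - τ by linarith) (by linarith)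
    linarith
  rcases hτ.eq_or_lt with hτq | hτq
  · rw [← hτq] at h ⊢
    exact entropy_sub_le_of_tendsto_zero hp0 hp1 hKn ht hfail hqδ h hrate
  · have hcont : Continuous fun σ => Real.binEntropy σ - Real.binEntropy (δ - σ) := by fun_prop
    refine le_of_tendsto (hcont.continuousWithinAt (s := Iio τ) (x := τ)).tendsto ?_
    have h2 : ∀ᶠ σ in 𝓝[<] τ, δ - σ < 1 / 2 := by
      have : Continuous fun σ : ℝ => δ - σ := by fun_prop
      exact (this.continuousWithinAt (s := Iio τ) (x := τ)).tendsto.eventually_lt_const h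
    filter_upwards [h2, Ioo_mem_nhdsLT hτq] with σ h3 h4
    have hlt : errorExponent p σ < errorExponent p τ :=
      errorExponent_strictMonoOn hp1 ⟨h4.1.le, by linarith [h4.2]⟩
        ⟨hτ, hτδ.trans hδ1⟩ h4.2
    obtain ⟨M, hM1, hM2⟩ := exists_between hlt
    exact entropy_sub_le_of_exponent hp0 hp1 hKn ht hM1 (hexp M hM2) (by linarith [h4.1])
      (by linarith [h4.2]) (by linarith [h4.2]) h3 hrate

theorem two_rpow_eq_exp (x : ℝ) : (2 : ℝ) ^ x = Real.exp (x * Real.log 2) := by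
  rw [Real.rpow_def_of_pos two_pos, mul_comm]

theorem hasRateAtMost_iff {B : ∀ n, Finset (ErasurePattern n)} {ρ : ℝ} :
    HasRateAtMost B ρ ↔ ∀ M, ρ * Real.log 2 < M →
      ∀ᶠ n : ℕ in atTop, ((B n).card : ℝ) ≤ Real.exp (n * M) := by
  have hL : 0 < Real.log 2 := Real.log_pos one_lt_two
  constructor
  · intro h M hM
    have h1 := h (M / Real.log 2 - ρ) (by rw [sub_pos, lt_div_iff₀ hL]; exact hM)
    filter_upwards [h1] with n hn
    rw [two_rpow_eq_exp, add_sub_cancel, mul_assoc, div_mul_cancel₀ _ hL.ne'] at hn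
    exact hn
  · intro h ε hε
    have h1 := h ((ρ + ε) * Real.log 2) (by nlinarith)
    filter_upwards [h1] with n hn
    rw [two_rpow_eq_exp, mul_assoc]
    exact hn

theorem achievesExponent_iff {A : Type*} [Fintype A] (hA : 2 ≤ Fintype.card A) {p : ℝ}
    {K : ℕ → ℕ} {B : ∀ n, Finset (ErasurePattern n)} {φ : ℝ} :
    AchievesExponent A p K B φ ↔
      Tendsto (fun n => erasureFailure p (K n) ((B n).image erasedSet)) atTop (𝓝 0) ∧
      ∀ M < φ * Real.log 2, ∀ᶠ n : ℕ in atTop,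
        erasureFailure p (K n) ((B n).image erasedSet) ≤ Real.exp (-(n * M)) := by
  have hL : 0 < Real.log 2 := Real.log_pos one_lt_two
  have : Nonempty A := Fintype.card_pos_iff.1 (by omega)
  unfold AchievesExponent
  simp only [failureProb_eq hA, forall_const]
  refine and_congr_right fun _ => ⟨fun h M hM => ?_, fun h ε hε => ?_⟩
  · have h1 := h (φ - M / Real.log 2) (by rw [sub_pos, div_lt_iff₀ hL]; exact hM)
    filter_upwards [h1] with n hn
    rw [two_rpow_eq_exp, sub_sub_cancel, neg_mul, mul_assoc, div_mul_cancel₀ _ hL.ne'] at hn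
    exact hn
  · have h1 := h ((φ - ε) * Real.log 2) (by nlinarith)
    filter_upwards [h1] with n hn
    rw [two_rpow_eq_exp, neg_mul, mul_assoc]
    exact hn

theorem card_image_patternOf_le {n : ℕ} (𝓔 : Finset (Finset (Fin n))) :
    ((𝓔.image patternOf).card : ℝ) ≤ 𝓔.card := by
  exact_mod_cast Finset.card_image_le

theorem attemptRate_eq {p : ℝ} {N : ℕ} (hN : 0 < N) (D F : ℝ) :
    attemptRate p N D F / N =
      max 0 (Real.binEntropy (1 - klBitsInv p (D / N) (F / N)) -
        Real.binEntropy (D / N - (1 - klBitsInv p (D / N) (F / N)))) / Real.log 2 := by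
  have hL : 0 < Real.log 2 := Real.log_pos one_lt_two
  have hN' : (N : ℝ) ≠ 0 := by exact_mod_cast hN.ne'
  have e : D / N - (1 - klBitsInv p (D / N) (F / N)) =
      klBitsInv p (D / N) (F / N) + D / N - 1 := by ring
  rw [attemptRate, mul_div_cancel_left₀ _ hN', e, Real.binEntropy_one_sub, entropyBits,
    entropyBits, ← sub_div, ← max_div_div_right hL.le, zero_div]

theorem theorem6 {A : Type*} [Fintype A] (hA : 2 ≤ Fintype.card A)
    (p : ℝ) (hp : (1 - p) / ((Fintype.card A : ℝ) - 1) < p) (hp1 : p < 1)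
    (N : ℕ) (hN : 0 < N) (D : ℝ) (hD : 1 - p < D / N) (hDN : D ≤ N)
    (F : ℝ) (hF : F ∈ Icc (0 : ℝ) (N * klBits (1 - D / N) p))
    (K : ℕ → ℕ)
    (hK : Tendsto (fun n : ℕ => ((n : ℝ) - (K n : ℝ) + 1) / n) atTop (𝓝 (D / N))) :
    BijOn (fun u => klBits u p) (Icc (1 - D / N) p) (Icc 0 (klBits (1 - D / N) p)) ∧
    IsLeast {R : ℝ | ∃ B : ∀ n, Finset (ErasurePattern n),
        HasRateAtMost B (R / N) ∧ AchievesExponent A p K B (F / N)}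
      (attemptRate p N D F) ∧
    (0 < F → D < N → ∃ B : ∀ n, Finset (ErasurePattern n),
        (∀ n, ((B n).card : ℝ) ≤ (2 : ℝ) ^ ((n : ℝ) * (attemptRate p N D F / N))) ∧
        AchievesExponent A p K B (F / N)) := by
  have hL : 0 < Real.log 2 := Real.log_pos one_lt_two
  have hN' : (0 : ℝ) < N := by exact_mod_cast hN
  have hp0 : 0 < p := by
    have : (2 : ℝ) ≤ Fintype.card A := by exact_mod_cast hA
    exact lt_of_le_of_lt (div_nonneg (by linarith) (by linarith)) hp
  have hδ1 : D / N ≤ 1 := (div_le_one hN').2 hDN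
  have hbij := klBits_bijOn hp0 hp1 hD hδ1
  refine ⟨hbij, ?_⟩
  have hrate := attemptRate_eq (p := p) hN D F
  set δ := D / N with hδdef
  set φ := F / N with hφdef
  have hφ : φ ∈ Icc 0 (klBits (1 - δ) p) :=
    ⟨div_nonneg hF.1 hN'.le, (div_le_iff₀' hN').2 hF.2⟩
  have himg := hbij.surjOn hφ
  have hu : klBitsInv p δ φ ∈ Icc (1 - δ) p := Function.invFunOn_mem himg
  have hku : klBits (klBitsInv p δ φ) p = φ := Function.invFunOn_eq himg
  -- The critical error rate: errors of relative weight beyond `τ` have exactly the allowed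
  -- exponent.
  set τ := 1 - klBitsInv p δ φ with hτdef
  have hτ : 1 - p ≤ τ := by linarith [hu.2]
  have hτδ : τ ≤ δ := by linarith [hu.1]
  have hΦ : φ * Real.log 2 = errorExponent p τ := by
    rw [← hku, klBits_eq hp0 hp1 (by linarith [hu.1]) (by linarith [hu.2]),
      div_mul_cancel₀ _ hL.ne']
  have hKn : ∀ᶠ n in atTop, K n ≤ n := by
    have h0 := (hK.sub tendsto_one_div_atTop_nhds_zero_nat).eventually_const_lt
      (show (0 : ℝ) < δ - 0 by linarith)
    filter_upwards [h0, eventually_gt_atTop 0] with n h1 h2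
    have hn' : (0 : ℝ) < n := by exact_mod_cast h2
    rw [← sub_div, lt_div_iff₀ hn'] at h1
    have : (K n : ℝ) ≤ n := by linarith
    exact_mod_cast this
  have ht : Tendsto (fun n => ((n - K n : ℕ) : ℝ) / n) atTop (𝓝 δ) := by
    have h0 := hK.sub tendsto_one_div_atTop_nhds_zero_nat
    rw [sub_zero] at h0
    refine h0.congr' ?_
    filter_upwards [hKn] with n hn
    rw [Nat.cast_sub hn]
    ring
  refine ⟨⟨?_, ?_⟩, ?_⟩
  · obtain ⟨𝓔, h1, h2, h3⟩ := exists_erasedSets_of_rate hp0 hp1 hτ hD hτδ hδ1 hKn ht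
    refine ⟨fun n => (𝓔 n).image patternOf, ?_, ?_⟩
    · rw [hrate, hasRateAtMost_iff, div_mul_cancel₀ _ hL.ne']
      intro M hM
      filter_upwards [h1 M hM] with n hn using (card_image_patternOf_le _).trans hn
    · rw [achievesExponent_iff hA, hΦ]
      simp only [image_erasedSet_image_patternOf]
      exact ⟨h2, h3⟩
  · rintro R ⟨B, hB, hach⟩
    rw [hasRateAtMost_iff] at hB
    rw [achievesExponent_iff hA, hΦ] at hach
    have h := max_entropy_sub_le_rate hp0 hp1 hτ hD hτδ hδ1 hKn ht
      (𝓔 := fun n => (B n).image erasedSet) (R := R / N * Real.log 2) (fun M hM => by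
        filter_upwards [hB M hM] with n hn
        exact le_trans (by exact_mod_cast Finset.card_image_le) hn) hach.1 hach.2
    rw [← div_le_iff₀ hL, ← hrate] at h
    exact (div_le_div_iff_of_pos_right hN').1 h
  · intro hF0 hDN'
    have hδ1' : δ < 1 := (div_lt_one hN').2 hDN'
    -- At `τ = 1 - p` the exponent is zero, which `0 < F` excludes.
    have hτ' : 1 - p < τ := by
      refine lt_of_le_of_ne hτ fun h => ?_
      rw [← h, errorExponent_one_sub] at hΦ
      exact (mul_pos (div_pos hF0 hN') hL).ne' hΦ
    obtain ⟨𝓔, h1, h2, h3⟩ := exists_erasedSets_of_card_le hp0 hp1 hτ' hτδ hδ1' hKn ht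
    refine ⟨fun n => (𝓔 n).image patternOf, fun n => ?_, ?_⟩
    · rw [hrate, two_rpow_eq_exp, mul_assoc, div_mul_cancel₀ _ hL.ne']
      exact (card_image_patternOf_le _).trans (h1 n)
    · rw [achievesExponent_iff hA, hΦ]
      simp only [image_erasedSet_image_patternOf]
      exact ⟨h2, h3⟩
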